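/- Let $\Bbbk$ be an algebraically closed field of characteristic zero, let $H$ be a semisimple Hopf algebra over $\Bbbk$, and let $A=\Bbbk\oplus A_1\oplus A_2\oplus\cdots$ be a connected graded $\Bbbk$-algebra that is a left $H$-module algebra (that is, $h(ab)=\sum h_1(a)h_2(b)$ and $h(1)=\epsilon(h)1$) such that every $A_n$ is an $H$-submodule. Suppose that $A$ is generated as an algebra by a finite-dimensional $H$-submodule $W\subseteq A_1$. Let $A\#H$ be the smash product, that is, $A\otimes H$ with $(a\#h)(a'\#h')=\sum a\,h_1(a')\#h_2h'$, graded by $(A\#H)_n=A_n\#H$. For a graded module $M$ let $M[n]$ be the shift with $M[n]_d=M_{n+d}$. Let $V^{(0)},\dots,V^{(s)}$ be a complete list of pairwise nonisomorphic simple left $H$-modules. Let $P^{(i)}=A\otimes V^{(i)}$ be the graded left $A\#H$-module with $(x\#h)(a\otimes v)=\sum x\,h_1(a)\otimes h_2v$ and with $A_n\otimes V^{(i)}$ in degree $n$. Regard $V^{(j)}$ as a graded left $A\#H$-module, concentrated in degree $0$, through the surjection $A\#H\to H$, $a\#h\mapsto\varepsilon_A(a)h$, where $\varepsilon_A:A\to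 A_0=\Bbbk$ is the augmentation. Then: 1. The modules $P^{(0)},\dots,P^{(s)}$ are pairwise nonisomorphic as graded $A\#H$-modules. Each $V^{(j)}$ has a minimal projective resolution $\cdots\to Q^{(j)}_1\to Q^{(j)}_0\to V^{(j)}\to 0$ by graded $A\#H$-modules (that is, $Q^{(j)}_0$ is a graded projective cover of $V^{(j)}$, and each further term is a graded projective cover of the kernel of the preceding map). 2. For every choice of such resolutions there are unique integers $m_{ij}\ge 0$ with $Q^{(j)}_1\cong\bigoplus_{i=0}^s (P^{(i)}[-1])^{\oplus m_{ij}}$ as graded $A\#H$-modules for all $j$. There are unique integers $n_{ij}\ge 0$ with $W\otimes V^{(j)}\cong\bigoplus_{i=0}^s (V^{(i)})^{\oplus n_{ij}}$ as $H$-modules for all $j$, where $h(w\otimes v)=\sum h_1w\otimes h_2v$. 3. Let the Gabriel quiver $\mathcal G(H,A)$ be the directed graph with vertices $P^{(0)},\dots,P^{(s)}$ and $m_{ij}$ arrows from $P^{(i)}$ to $P^{(j)}$, and let the McKay quiver $(W)\mathcal M$ be the directed graph with vertices $V^{(0)},\dots,V^{(s)}$ and $n_{ij}$ arrows from $V^{(i)}$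 to $V^{(j)}$. Then $\mathcal G(H,A)$ and $(W)\mathcal M$ are isomorphic as directed graphs, by an isomorphism that sends $P^{(i)}$ to $V^{(i)}$ for every $i$. -/

import Mathlib

open scoped TensorProduct

universe u

noncomputable section

namespace HopfMcKay

section Actions

variable (𝕜 : Type u) [Field 𝕜] (H : Type u) [Ring H] [HopfAlgebra 𝕜 H]

/-- The diagonal action of `H` on `M ⊗ N`: `h · (m ⊗ n) = ∑ h₁ m ⊗ h₂ n`, where
`Δ(h) = ∑ h₁ ⊗ h₂`. -/
def diagAction (M N : Type u)
    [AddCommGroup M] [Module 𝕜 M] [Module H M] [IsScalarTower 𝕜 H M]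
    [AddCommGroup N] [Module 𝕜 N] [Module H N] [IsScalarTower 𝕜 H N] :
    H →ₐ[𝕜] Module.End 𝕜 (M ⊗[𝕜] N) :=
  (Module.endTensorEndAlgHom (R := 𝕜) (S := 𝕜) (A := 𝕜) (M := M) (N := N)).comp
    ((Algebra.TensorProduct.map (Algebra.lsmul 𝕜 𝕜 M) (Algebra.lsmul 𝕜 𝕜 N)).comp
      (Bialgebra.comulAlgHom 𝕜 H))

theorem diagAction_apply_tmul {M N : Type u}
    [AddCommGroup M] [Module 𝕜 M] [Module H M] [IsScalarTower 𝕜 H M]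
    [AddCommGroup N] [Module 𝕜 N] [Module H N] [IsScalarTower 𝕜 H N] (h : H) (m : M) (n : N) :
    diagAction 𝕜 H M N h (m ⊗ₜ n) =
      TensorProduct.map ((LinearMap.toSpanSingleton H M m).restrictScalars 𝕜)
        ((LinearMap.toSpanSingleton H N n).restrictScalars 𝕜) (Coalgebra.comul h) := by
  change Module.endTensorEndAlgHom (R := 𝕜) (S := 𝕜) (A := 𝕜) (M := M) (N := N)
    (Algebra.TensorProduct.map (Algebra.lsmul 𝕜 𝕜 M) (Algebra.lsmul 𝕜 𝕜 N)
      (Coalgebra.comul (R := 𝕜) h)) (m ⊗ₜ n) = _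
  induction (Coalgebra.comul (R := 𝕜) h) using TensorProduct.induction_on with
  | zero => simp
  | tmul x y => simp [Module.endTensorEndAlgHom_apply]
  | add x y hx hy => rw [map_add, map_add, LinearMap.add_apply, hx, hy, map_add]

theorem diagAction_apply_repr {M N : Type u} {ι : Type*}
    [AddCommGroup M] [Module 𝕜 M] [Module H M] [IsScalarTower 𝕜 H M]
    [AddCommGroup N] [Module 𝕜 N] [Module H N] [IsScalarTower 𝕜 H N] (h : H)
    (r : Coalgebra.Repr 𝕜 h ι) (m : M) (n : N) :
    diagAction 𝕜 H M N h (m ⊗ₜ n) =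
      ∑ i ∈ r.index, (r.left i • m) ⊗ₜ[𝕜] (r.right i • n) := by
  rw [diagAction_apply_tmul, ← r.eq, map_sum]
  simp

/-- The tensor product `M ⊗ N` of two left `H`-modules, with the diagonal action of `H`.
(A type synonym, as Mathlib lets `H` act on `M ⊗[𝕜] N` through the left factor alone.) -/
def DiagTensor (M N : Type u) [AddCommGroup M] [Module 𝕜 M] [AddCommGroup N] [Module 𝕜 N] :
    Type u := M ⊗[𝕜] N

instance (M N : Type u) [AddCommGroup M] [Module 𝕜 M] [AddCommGroup N] [Module 𝕜 N] :
    AddCommGroup (DiagTensor 𝕜 M N) := inferInstanceAs (AddCommGroup (M ⊗[𝕜] N))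

instance (M N : Type u) [AddCommGroup M] [Module 𝕜 M] [AddCommGroup N] [Module 𝕜 N] :
    Module 𝕜 (DiagTensor 𝕜 M N) := inferInstanceAs (Module 𝕜 (M ⊗[𝕜] N))

instance (M N : Type u)
    [AddCommGroup M] [Module 𝕜 M] [Module H M] [IsScalarTower 𝕜 H M]
    [AddCommGroup N] [Module 𝕜 N] [Module H N] [IsScalarTower 𝕜 H N] :
    Module H (DiagTensor 𝕜 M N) :=
  Module.compHom (M ⊗[𝕜] N) (diagAction 𝕜 H M N).toRingHom

variable {M N : Type u} [AddCommGroup M] [Module 𝕜 M] [AddCommGroup N] [Module 𝕜 N] in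
/-- The pure tensor `m ⊗ n`. -/
def DiagTensor.mk (m : M) (n : N) : DiagTensor 𝕜 M N := m ⊗ₜ[𝕜] n

variable {H} in
/-- The diagonal action `h · (m ⊗ n) = ∑ h₁ m ⊗ h₂ n`. -/
theorem DiagTensor.smul_mk {M N : Type u} {ι : Type*}
    [AddCommGroup M] [Module 𝕜 M] [Module H M] [IsScalarTower 𝕜 H M]
    [AddCommGroup N] [Module 𝕜 N] [Module H N] [IsScalarTower 𝕜 H N] (h : H)
    (r : Coalgebra.Repr 𝕜 h ι) (m : M) (n : N) :
    h • DiagTensor.mk 𝕜 m n = ∑ i ∈ r.index, DiagTensor.mk 𝕜 (r.left i • m) (r.right i • n) :=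
  diagAction_apply_repr 𝕜 H h r m n

/-- `A` is a left `H`-module algebra: the `H`-action is `𝕜`-bilinear,
`h (a b) = ∑ h₁(a) h₂(b)` and `h 1 = ε(h) 1`. -/
class HModuleAlgebra (A : Type u) [Ring A] [Algebra 𝕜 A] [Module H A] : Prop
    extends IsScalarTower 𝕜 H A where
  smul_mul : ∀ (h : H) (a b : A),
    h • (a * b) = LinearMap.mul' 𝕜 A (diagAction 𝕜 H A A h (a ⊗ₜ b))
  smul_one : ∀ h : H, h • (1 : A) = algebraMap 𝕜 A (Coalgebra.counit h)

variable (A : Type u) [Ring A] [Algebra 𝕜 A] [Module H A]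

/-- For `x = a ⊗ h` the operator `a' ⊗ v ↦ ∑ a h₁(a') ⊗ h₂ v` on `A ⊗ V`. -/
def smashOp [IsScalarTower 𝕜 H A] (V : Type u) [AddCommGroup V] [Module 𝕜 V] [Module H V]
    [IsScalarTower 𝕜 H V] : A ⊗[𝕜] H →ₗ[𝕜] Module.End 𝕜 (A ⊗[𝕜] V) :=
  TensorProduct.lift
    ((LinearMap.mul 𝕜 (Module.End 𝕜 (A ⊗[𝕜] V))).compl₁₂
      (LinearMap.rTensorHom V ∘ₗ LinearMap.mul 𝕜 A)
      (diagAction 𝕜 H A V).toLinearMap)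

variable {𝕜 H A}

theorem smashOp_tmul_apply [IsScalarTower 𝕜 H A] {V : Type u} [AddCommGroup V] [Module 𝕜 V]
    [Module H V] [IsScalarTower 𝕜 H V] (a : A) (h : H) (z : A ⊗[𝕜] V) :
    smashOp 𝕜 H A V (a ⊗ₜ h) z =
      (LinearMap.mulLeft 𝕜 a).rTensor V (diagAction 𝕜 H A V h z) := rfl

variable [HModuleAlgebra 𝕜 H A] {V : Type u} [AddCommGroup V] [Module 𝕜 V]
    [Module H V] [IsScalarTower 𝕜 H V]

theorem smashOp_mulLeft (a : A) (z : A ⊗[𝕜] H) (w : A ⊗[𝕜] V) :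
    smashOp 𝕜 H A V ((LinearMap.mulLeft 𝕜 a).rTensor H z) w =
      (LinearMap.mulLeft 𝕜 a).rTensor V (smashOp 𝕜 H A V z w) := by
  induction z using TensorProduct.induction_on with
  | zero => simp
  | tmul b h =>
    rw [LinearMap.rTensor_tmul, smashOp_tmul_apply, smashOp_tmul_apply, LinearMap.mulLeft_apply,
      LinearMap.mulLeft_mul, LinearMap.rTensor_comp, LinearMap.comp_apply]
  | add x y hx hy => simp only [map_add, LinearMap.add_apply, hx, hy]

theorem smashOp_diagAction_tmul (h g : H) (a b : A) (v : V) :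
    smashOp 𝕜 H A V (diagAction 𝕜 H A H h (a ⊗ₜ g)) (b ⊗ₜ v) =
      diagAction 𝕜 H A V h (smashOp 𝕜 H A V (a ⊗ₜ g) (b ⊗ₜ v)) := by
  have key : ∀ (b : A) (v : V),
      smashOp 𝕜 H A V (diagAction 𝕜 H A H h (a ⊗ₜ 1)) (b ⊗ₜ v) =
        diagAction 𝕜 H A V h ((a * b) ⊗ₜ v) := by
    intro b v
    let r (x : A) : H →ₗ[𝕜] A := (LinearMap.toSpanSingleton H A x).restrictScalars 𝕜
    let T : H ⊗[𝕜] (H ⊗[𝕜] H) →ₗ[𝕜] A ⊗[𝕜] V :=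
      (LinearMap.mul' 𝕜 A).rTensor V ∘ₗ (TensorProduct.assoc 𝕜 A A V).symm.toLinearMap ∘ₗ
        TensorProduct.map (r a) (TensorProduct.map (r b)
          ((LinearMap.toSpanSingleton H V v).restrictScalars 𝕜))
    have h1 : ∀ t : H ⊗[𝕜] H,
        smashOp 𝕜 H A V (TensorProduct.map (r a)
          ((LinearMap.toSpanSingleton H H (1 : H)).restrictScalars 𝕜) t) (b ⊗ₜ v) =
        T (Coalgebra.comul.lTensor H t) := by
      intro t
      induction t using TensorProduct.induction_on with
      | zero => simp
      | tmul x y =>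
        have : ∀ s : H ⊗[𝕜] H,
            (LinearMap.mulLeft 𝕜 (x • a)).rTensor V (TensorProduct.map (r b)
              ((LinearMap.toSpanSingleton H V v).restrictScalars 𝕜) s) = T (x ⊗ₜ s) := by
          intro s
          induction s using TensorProduct.induction_on with
          | zero => simp
          | tmul p q => simp [T, r]
          | add p q hp hq => rw [TensorProduct.tmul_add, map_add, map_add, map_add, hp, hq]
        rw [LinearMap.lTensor_tmul, ← this, TensorProduct.map_tmul]
        simp only [r, LinearMap.restrictScalars_apply, LinearMap.toSpanSingleton_apply, smul_eq_mul,
          mul_one]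
        rw [smashOp_tmul_apply, diagAction_apply_tmul]
      | add p q hp hq => simp only [map_add, LinearMap.add_apply, hp, hq]
    have h2 : ∀ t : H ⊗[𝕜] H,
        TensorProduct.map (r (a * b))
          ((LinearMap.toSpanSingleton H V v).restrictScalars 𝕜) t =
        T (TensorProduct.assoc 𝕜 H H H (Coalgebra.comul.rTensor H t)) := by
      intro t
      induction t using TensorProduct.induction_on with
      | zero => simp
      | tmul x y =>
        have : ∀ s : H ⊗[𝕜] H,
            (LinearMap.mul' 𝕜 A (TensorProduct.map (r a) (r b) s)) ⊗ₜ (y • v) =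
            T (TensorProduct.assoc 𝕜 H H H (s ⊗ₜ y)) := by
          intro s
          induction s using TensorProduct.induction_on with
          | zero => simp
          | tmul p q => simp [T, r]
          | add p q hp hq =>
            rw [TensorProduct.add_tmul, map_add, map_add, map_add, map_add,
              TensorProduct.add_tmul, hp, hq]
        rw [LinearMap.rTensor_tmul, ← this, TensorProduct.map_tmul]
        have e := HModuleAlgebra.smul_mul (𝕜 := 𝕜) x a b
        rw [diagAction_apply_tmul] at e
        simp only [r, LinearMap.restrictScalars_apply, LinearMap.toSpanSingleton_apply]
        rw [e]
      | add p q hp hq => simp only [map_add, hp, hq]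
    rw [diagAction_apply_tmul, diagAction_apply_tmul]
    exact (h1 _).trans (by rw [← Coalgebra.coassoc_apply]; exact (h2 _).symm)
  have right : ∀ (z : A ⊗[𝕜] H) (w : A ⊗[𝕜] V),
      smashOp 𝕜 H A V ((LinearMap.mulRight 𝕜 g).lTensor A z) w =
        smashOp 𝕜 H A V z (diagAction 𝕜 H A V g w) := by
    intro z w
    induction z using TensorProduct.induction_on with
    | zero => simp
    | tmul x y =>
      rw [LinearMap.lTensor_tmul, smashOp_tmul_apply, smashOp_tmul_apply,
        LinearMap.mulRight_apply, map_mul, Module.End.mul_apply]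
    | add p q hp hq => simp only [map_add, LinearMap.add_apply, hp, hq]
  have key' : ∀ w : A ⊗[𝕜] V,
      smashOp 𝕜 H A V (diagAction 𝕜 H A H h (a ⊗ₜ 1)) w =
        diagAction 𝕜 H A V h ((LinearMap.mulLeft 𝕜 a).rTensor V w) := by
    intro w
    induction w using TensorProduct.induction_on with
    | zero => simp
    | tmul x y => rw [key]; simp
    | add p q hp hq => simp only [map_add, hp, hq]
  have e : diagAction 𝕜 H A H h (a ⊗ₜ g) =
      (LinearMap.mulRight 𝕜 g).lTensor A (diagAction 𝕜 H A H h (a ⊗ₜ 1)) := by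
    rw [diagAction_apply_tmul, diagAction_apply_tmul]
    induction (Coalgebra.comul (R := 𝕜) h) using TensorProduct.induction_on with
    | zero => simp
    | tmul x y => simp
    | add p q hp hq => simp only [map_add, hp, hq]
  rw [e, right, key', smashOp_tmul_apply]

theorem smashOp_mul (x y : A ⊗[𝕜] H) :
    smashOp 𝕜 H A V (smashOp 𝕜 H A H x y) = smashOp 𝕜 H A V x * smashOp 𝕜 H A V y := by
  induction x using TensorProduct.induction_on with
  | zero => simp
  | add p q hp hq => simp only [map_add, LinearMap.add_apply, hp, hq, add_mul]
  | tmul a h =>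
    induction y using TensorProduct.induction_on with
    | zero => simp
    | add p q hp hq => simp only [map_add, hp, hq, mul_add]
    | tmul b g =>
      refine TensorProduct.ext' fun c v => ?_
      rw [smashOp_tmul_apply, smashOp_mulLeft, smashOp_diagAction_tmul, Module.End.mul_apply,
        smashOp_tmul_apply a h]

theorem smashOp_one : smashOp 𝕜 H A V (1 ⊗ₜ 1) = 1 := by
  refine LinearMap.ext fun z => ?_
  rw [smashOp_tmul_apply, map_one, LinearMap.mulLeft_one]
  simp

theorem smashOp_apply_one (x : A ⊗[𝕜] H) : smashOp 𝕜 H A H x (1 ⊗ₜ 1) = x := by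
  induction x using TensorProduct.induction_on with
  | zero => rw [map_zero, LinearMap.zero_apply]
  | add p q hp hq => rw [map_add, LinearMap.add_apply, hp, hq]
  | tmul a h =>
    have e : ∀ t : H ⊗[𝕜] H,
        (LinearMap.mulLeft 𝕜 a).rTensor H (TensorProduct.map
          ((LinearMap.toSpanSingleton H A (1 : A)).restrictScalars 𝕜)
          ((LinearMap.toSpanSingleton H H (1 : H)).restrictScalars 𝕜) t) =
        a ⊗ₜ (TensorProduct.lid 𝕜 H (Coalgebra.counit.rTensor H t)) := by
      intro t
      induction t using TensorProduct.induction_on with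
      | zero => simp
      | tmul x y =>
        simp [HModuleAlgebra.smul_one (𝕜 := 𝕜), Algebra.algebraMap_eq_smul_one,
          TensorProduct.smul_tmul]
      | add p q hp hq => simp only [map_add, TensorProduct.tmul_add, hp, hq]
    rw [smashOp_tmul_apply, diagAction_apply_tmul, e, Coalgebra.rTensor_counit_comul]
    simp

end Actions

section Smash

variable (𝕜 : Type u) [Field 𝕜] (H : Type u) [Ring H] [HopfAlgebra 𝕜 H]
  (A : Type u) [Ring A] [Algebra 𝕜 A] [Module H A]

/-- The smash product `A # H`: the vector space `A ⊗ H` with the multiplication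
`(a # h)(a' # h') = ∑ a h₁(a') # h₂ h'`. -/
def SmashProduct : Type u := A ⊗[𝕜] H

instance : AddCommGroup (SmashProduct 𝕜 H A) := inferInstanceAs (AddCommGroup (A ⊗[𝕜] H))

instance : Module 𝕜 (SmashProduct 𝕜 H A) := inferInstanceAs (Module 𝕜 (A ⊗[𝕜] H))

variable {𝕜 H A} in
/-- The element `a # h` of the smash product. -/
def SmashProduct.mk (a : A) (h : H) : SmashProduct 𝕜 H A := a ⊗ₜ[𝕜] h

variable [HModuleAlgebra 𝕜 H A]

instance : Ring (SmashProduct 𝕜 H A) :=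
  { (inferInstance : AddCommGroup (SmashProduct 𝕜 H A)) with
    mul := fun x y => smashOp 𝕜 H A H x y
    one := SmashProduct.mk 1 1
    left_distrib := fun x y z => map_add (smashOp 𝕜 H A H x) y z
    right_distrib := fun x y z => LinearMap.congr_fun (map_add (smashOp 𝕜 H A H) x y) z
    zero_mul := fun x => LinearMap.congr_fun (map_zero (smashOp 𝕜 H A H)) x
    mul_zero := fun x => map_zero (smashOp 𝕜 H A H x)
    mul_assoc := fun x y z => LinearMap.congr_fun (smashOp_mul (V := H) x y) z
    one_mul := fun x => LinearMap.congr_fun (smashOp_one (V := H)) x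
    mul_one := fun x => smashOp_apply_one x }

variable {𝕜 H A}

/-- The multiplication rule `(a # h)(a' # h') = ∑ a h₁(a') # h₂ h'`. -/
theorem SmashProduct.mk_mul_mk {ι : Type*} (a a' : A) (h h' : H) (r : Coalgebra.Repr 𝕜 h ι) :
    (SmashProduct.mk a h * SmashProduct.mk a' h' : SmashProduct 𝕜 H A) =
      ∑ i ∈ r.index, SmashProduct.mk (a * r.left i • a') (r.right i * h') := by
  change smashOp 𝕜 H A H (a ⊗ₜ h) (a' ⊗ₜ h') = _
  rw [smashOp_tmul_apply, diagAction_apply_repr 𝕜 H h r, map_sum]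
  rfl

instance (V : Type u) [AddCommGroup V] [Module 𝕜 V] [Module H V] [IsScalarTower 𝕜 H V] :
    Module (SmashProduct 𝕜 H A) (DiagTensor 𝕜 A V) :=
  Module.compHom (A ⊗[𝕜] V)
    ({ toFun := smashOp 𝕜 H A V
       map_one' := smashOp_one
       map_mul' := smashOp_mul
       map_zero' := map_zero _
       map_add' := map_add _ } : SmashProduct 𝕜 H A →+* Module.End 𝕜 (A ⊗[𝕜] V))

/-- The `A # H`-module structure `(x # h)(a ⊗ v) = ∑ x h₁(a) ⊗ h₂ v` on `A ⊗ V`. -/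
theorem SmashProduct.mk_smul_tmul {ι : Type*} {V : Type u} [AddCommGroup V] [Module 𝕜 V]
    [Module H V] [IsScalarTower 𝕜 H V] (x a : A) (h : H) (v : V) (r : Coalgebra.Repr 𝕜 h ι) :
    (SmashProduct.mk x h : SmashProduct 𝕜 H A) • DiagTensor.mk 𝕜 a v =
      ∑ i ∈ r.index, DiagTensor.mk 𝕜 (x * r.left i • a) (r.right i • v) := by
  change smashOp 𝕜 H A V (x ⊗ₜ h) (a ⊗ₜ v) = _
  rw [smashOp_tmul_apply, diagAction_apply_repr 𝕜 H h r, map_sum]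
  rfl

end Smash

section Graded

variable (𝕜 : Type u) [Field 𝕜] (H : Type u) [Ring H] [HopfAlgebra 𝕜 H]
  {A : Type u} [Ring A] [Algebra 𝕜 A]

variable {𝕜} in
/-- The `ℕ`-graded algebra `A` is connected: `A ≠ 0` and `A₀ = 𝕜 · 1`. -/
class ConnectedGraded (𝒜 : ℕ → Submodule 𝕜 A) : Prop where
  nontrivial : Nontrivial A
  zero_eq : 𝒜 0 = 1

variable {𝕜} in
/-- The action of `H` preserves the grading: each homogeneous component is `H`-stable. -/
class GradedAction [Module H A] (𝒜 : ℕ → Submodule 𝕜 A) : Prop where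
  smul_mem : ∀ (h : H) (n : ℕ) (a : A), a ∈ 𝒜 n → h • a ∈ 𝒜 n

section Augmentation

variable {𝕜} (𝒜 : ℕ → Submodule 𝕜 A) [GradedAlgebra 𝒜] [ConnectedGraded 𝒜]

theorem algebraMap_zero_bijective : Function.Bijective (algebraMap 𝕜 (𝒜 0)) := by
  have := ConnectedGraded.nontrivial (𝒜 := 𝒜)
  refine ⟨fun x y h => ?_, fun x => ?_⟩
  · exact (algebraMap 𝕜 A).injective (congrArg Subtype.val h)
  · have hx : (x : A) ∈ (1 : Submodule 𝕜 A) := by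
      rw [← ConnectedGraded.zero_eq (𝒜 := 𝒜)]; exact x.2
    obtain ⟨c, hc⟩ := Submodule.mem_one.1 hx
    exact ⟨c, Subtype.ext hc⟩

/-- The augmentation `A → A₀ = 𝕜` of a connected graded algebra. -/
def augmentation : A →+* 𝕜 :=
  (RingEquiv.ofBijective (algebraMap 𝕜 (𝒜 0)) (algebraMap_zero_bijective 𝒜)).symm.toRingHom.comp
    (GradedRing.projZeroRingHom' 𝒜)

theorem algebraMap_augmentation (a : A) :
    algebraMap 𝕜 A (augmentation 𝒜 a) = GradedRing.projZeroRingHom 𝒜 a := by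
  have h := (RingEquiv.ofBijective (algebraMap 𝕜 (𝒜 0))
    (algebraMap_zero_bijective 𝒜)).apply_symm_apply (GradedRing.projZeroRingHom' 𝒜 a)
  exact congrArg Subtype.val h

theorem augmentation_eq_of {a : A} {c : 𝕜}
    (h : algebraMap 𝕜 A c = GradedRing.projZeroRingHom 𝒜 a) : augmentation 𝒜 a = c := by
  have := ConnectedGraded.nontrivial (𝒜 := 𝒜)
  exact (algebraMap 𝕜 A).injective ((algebraMap_augmentation 𝒜 a).trans h.symm)

theorem augmentation_algebraMap (c : 𝕜) : augmentation 𝒜 (algebraMap 𝕜 A c) = c := by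
  refine augmentation_eq_of 𝒜 ?_
  exact (DirectSum.decompose_of_mem_same 𝒜 (SetLike.algebraMap_mem_graded 𝒜 c)).symm

theorem augmentation_smul (c : 𝕜) (a : A) : augmentation 𝒜 (c • a) = c * augmentation 𝒜 a := by
  rw [Algebra.smul_def, map_mul, augmentation_algebraMap]

/-- The underlying linear map of the projection `A # H → H`. -/
def smashToHopfAux : A ⊗[𝕜] H →ₗ[𝕜] H :=
  TensorProduct.lift (LinearMap.lsmul 𝕜 H ∘ₗ
    ({ toFun := augmentation 𝒜
       map_add' := map_add _
       map_smul' := augmentation_smul 𝒜 } : A →ₗ[𝕜] 𝕜))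

theorem smashToHopfAux_tmul (a : A) (h : H) :
    smashToHopfAux H 𝒜 (a ⊗ₜ h) = augmentation 𝒜 a • h := rfl

variable {H} [Module H A] [HModuleAlgebra 𝕜 H A] [GradedAction H 𝒜]

theorem augmentation_hsmul (h : H) (a : A) :
    augmentation 𝒜 (h • a) = Coalgebra.counit (R := 𝕜) h * augmentation 𝒜 a := by
  induction a using DirectSum.Decomposition.inductionOn 𝒜 with
  | zero => simp
  | @homogeneous i m =>
    by_cases hi : i = 0
    · subst hi
      obtain ⟨c, hc⟩ := (algebraMap_zero_bijective 𝒜).2 m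
      have hm : (m : A) = algebraMap 𝕜 A c := by rw [← hc]; rfl
      rw [hm, augmentation_algebraMap, Algebra.algebraMap_eq_smul_one, smul_comm,
        augmentation_smul, HModuleAlgebra.smul_one (𝕜 := 𝕜), augmentation_algebraMap, mul_comm]
    · have z : ∀ x ∈ 𝒜 i, augmentation 𝒜 x = 0 := by
        intro x hx
        refine augmentation_eq_of 𝒜 ?_
        rw [map_zero]
        exact (DirectSum.decompose_of_mem_ne 𝒜 hx hi).symm
      rw [z _ m.2, z _ (GradedAction.smul_mem h i _ m.2), mul_zero]
  | add p q hp hq => rw [smul_add, map_add, map_add, hp, hq, mul_add]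

variable (H)

theorem smashToHopfAux_mul (x y : A ⊗[𝕜] H) :
    smashToHopfAux H 𝒜 (smashOp 𝕜 H A H x y) =
      smashToHopfAux H 𝒜 x * smashToHopfAux H 𝒜 y := by
  induction x using TensorProduct.induction_on with
  | zero => simp
  | add p q hp hq => simp only [map_add, LinearMap.add_apply, hp, hq, add_mul]
  | tmul a h =>
    induction y using TensorProduct.induction_on with
    | zero => simp
    | add p q hp hq => simp only [map_add, hp, hq, mul_add]
    | tmul b g =>
      have e : ∀ t : H ⊗[𝕜] H,
          smashToHopfAux H 𝒜 ((LinearMap.mulLeft 𝕜 a).rTensor H (TensorProduct.map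
            ((LinearMap.toSpanSingleton H A b).restrictScalars 𝕜)
            ((LinearMap.toSpanSingleton H H g).restrictScalars 𝕜) t)) =
          (augmentation 𝒜 a * augmentation 𝒜 b) •
            (TensorProduct.lid 𝕜 H (Coalgebra.counit.rTensor H t) * g) := by
        intro t
        induction t using TensorProduct.induction_on with
        | zero => simp
        | tmul x y =>
          simp [smashToHopfAux_tmul, augmentation_hsmul, smul_smul, mul_left_comm, mul_comm]
        | add p q hp hq => simp only [map_add, hp, hq, add_mul, smul_add]
      rw [smashOp_tmul_apply, diagAction_apply_tmul, e, Coalgebra.rTensor_counit_comul,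
        smashToHopfAux_tmul, smashToHopfAux_tmul]
      simp [smul_smul, mul_comm]

/-- The surjection of algebras `A # H → H`, `a # h ↦ ε(a) h`, where `ε : A → 𝕜` is the
augmentation. -/
def smashToHopf : SmashProduct 𝕜 H A →+* H where
  toFun := smashToHopfAux H 𝒜
  map_one' := by
    change smashToHopfAux H 𝒜 (1 ⊗ₜ 1) = 1
    rw [smashToHopfAux_tmul, map_one, one_smul]
  map_mul' := smashToHopfAux_mul H 𝒜
  map_zero' := map_zero _
  map_add' := map_add _

end Augmentation

section Modules

variable {𝕜} [Module H A] (𝒜 : ℕ → Submodule 𝕜 A)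

/-- The homogeneous component `(A # H)ₙ = Aₙ # H` (elements of `H` have degree `0`). -/
def smashDegree (n : ℕ) : Submodule 𝕜 (SmashProduct 𝕜 H A) :=
  LinearMap.range ((𝒜 n).subtype.rTensor H)

/-- A family of subgroups with projections is an internal direct sum decomposition. -/
theorem isInternal_of_proj {M : Type u} [AddCommGroup M] (deg : ℤ → AddSubgroup M)
    (p : ℤ → M →+ M) (h1 : ∀ d, ∀ x ∈ deg d, p d x = x)
    (h2 : ∀ d e, e ≠ d → ∀ x ∈ deg d, p e x = 0) (h3 : ∀ x, x ∈ ⨆ d, deg d) :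
    DirectSum.IsInternal deg := by
  classical
  have key : ∀ (e : ℤ) (x : DirectSum ℤ fun d => deg d),
      p e (DirectSum.coeAddMonoidHom deg x) = x e := by
    intro e x
    induction x using DirectSum.induction_on with
    | zero => simp
    | of d y =>
      rw [DirectSum.coeAddMonoidHom_of]
      by_cases h : e = d
      · subst h
        rw [h1 _ _ y.2, DirectSum.of_eq_same]
      · rw [h2 d e h _ y.2, DirectSum.of_eq_of_ne _ _ _ h]
        rfl
    | add x y hx hy => rw [map_add, map_add, hx, hy]; rfl
  constructor
  · intro x y hxy
    refine DFinsupp.ext fun e => Subtype.ext ?_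
    rw [← key, ← key, hxy]
  · intro x
    refine AddSubgroup.iSup_induction (C := fun x => ∃ a, DirectSum.coeAddMonoidHom deg a = x)
      deg (h3 x) (fun d x hx => ?_) ⟨0, map_zero _⟩ ?_
    · exact ⟨DirectSum.of (fun d => deg d) d ⟨x, hx⟩, DirectSum.coeAddMonoidHom_of _ _ _⟩
    · rintro _ _ ⟨a, rfl⟩ ⟨b, rfl⟩
      exact ⟨a + b, map_add _ _ _⟩

theorem exists_proj_of_isInternal {M : Type u} [AddCommGroup M] {deg : ℤ → AddSubgroup M}
    (h : DirectSum.IsInternal deg) :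
    ∃ p : ℤ → M →+ M, (∀ d, ∀ x ∈ deg d, p d x = x) ∧
      (∀ d e, e ≠ d → ∀ x ∈ deg d, p e x = 0) ∧ ∀ x, x ∈ ⨆ d, deg d := by
  classical
  let φ := AddEquiv.ofBijective _ h
  have hφ : ∀ d (x : deg d), φ.symm x = DirectSum.of (fun d => deg d) d x := by
    intro d x
    rw [AddEquiv.symm_apply_eq]
    exact (DirectSum.coeAddMonoidHom_of deg d x).symm
  refine ⟨fun d => (deg d).subtype.comp ((DFinsupp.evalAddMonoidHom d).comp φ.symm.toAddMonoidHom),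
    fun d x hx => ?_, fun d e hde x hx => ?_, fun x => ?_⟩
  · change ((φ.symm x) d : M) = x
    rw [hφ d ⟨x, hx⟩, DirectSum.of_eq_same]
  · change ((φ.symm x) e : M) = 0
    rw [hφ d ⟨x, hx⟩, DirectSum.of_eq_of_ne _ _ _ hde]
    rfl
  · obtain ⟨y, rfl⟩ := h.2 x
    induction y using DirectSum.induction_on with
    | zero => rw [map_zero]; exact zero_mem _
    | of d y =>
      rw [DirectSum.coeAddMonoidHom_of]
      exact AddSubgroup.mem_iSup_of_mem d y.2
    | add x y hx hy => rw [map_add]; exact add_mem hx hy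

variable [HModuleAlgebra 𝕜 H A]

/-- A `ℤ`-graded left module over the graded algebra `A # H`. -/
structure GradedModule : Type (u + 1) where
  carrier : Type u
  [addCommGroup : AddCommGroup carrier]
  [module : Module (SmashProduct 𝕜 H A) carrier]
  deg : ℤ → AddSubgroup carrier
  isInternal : DirectSum.IsInternal deg
  smul_mem : ∀ (n : ℕ) (d : ℤ) (x : SmashProduct 𝕜 H A) (m : carrier),
    x ∈ smashDegree H 𝒜 n → m ∈ deg d → x • m ∈ deg (n + d)

namespace GradedModule

attribute [instance] GradedModule.addCommGroup GradedModule.module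

variable {H 𝒜}

/-- Isomorphism of graded modules (of degree zero). -/
def Isomorphic (M N : GradedModule H 𝒜) : Prop :=
  ∃ e : M.carrier ≃ₗ[SmashProduct 𝕜 H A] N.carrier, ∀ d x, e x ∈ N.deg d ↔ x ∈ M.deg d

/-- A homomorphism of modules is graded if it preserves degrees. -/
def IsGradedHom {M N : GradedModule H 𝒜}
    (f : M.carrier →ₗ[SmashProduct 𝕜 H A] N.carrier) : Prop :=
  ∀ d, ∀ x ∈ M.deg d, f x ∈ N.deg d

/-- The submodule `N` of `M` is a graded submodule: it is the sum of the `N ∩ M_d`. -/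
def IsGradedSubmodule (M : GradedModule H 𝒜)
    (N : Submodule (SmashProduct 𝕜 H A) M.carrier) : Prop :=
  N.toAddSubgroup = ⨆ d, N.toAddSubgroup ⊓ M.deg d

/-- `f : P → M` maps `P` onto the submodule `K` of `M`, making it a projective cover of `K` in the
category of graded modules: `P` is projective, `f` is graded with image `K`, and the kernel of `f`
is superfluous among the graded submodules of `P`. -/
structure IsProjectiveCover {P M : GradedModule H 𝒜}
    (f : P.carrier →ₗ[SmashProduct 𝕜 H A] M.carrier)
    (K : Submodule (SmashProduct 𝕜 H A) M.carrier) : Prop where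
  projective : Module.Projective (SmashProduct 𝕜 H A) P.carrier
  graded : IsGradedHom f
  range_eq : LinearMap.range f = K
  superfluous : ∀ N : Submodule (SmashProduct 𝕜 H A) P.carrier,
    P.IsGradedSubmodule N → LinearMap.ker f ⊔ N = ⊤ → N = ⊤

/-- A minimal projective resolution `⋯ → Q₂ → Q₁ → Q₀ → M → 0` of a graded module: `Q₀` is a
projective cover of `M`, and `Qₙ₊₁` is a projective cover of the kernel of the map out of `Qₙ`. -/
structure MinimalResolution (M : GradedModule H 𝒜) where
  Q : ℕ → GradedModule H 𝒜
  π : (Q 0).carrier →ₗ[SmashProduct 𝕜 H A] M.carrier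
  d : ∀ n, (Q (n + 1)).carrier →ₗ[SmashProduct 𝕜 H A] (Q n).carrier
  cover_zero : IsProjectiveCover π ⊤
  cover_one : IsProjectiveCover (d 0) (LinearMap.ker π)
  cover_succ : ∀ n, IsProjectiveCover (d (n + 1)) (LinearMap.ker (d n))

/-- The degree shift `M[n]`, with `M[n]_d = M_{n + d}`. -/
def shift (M : GradedModule H 𝒜) (n : ℤ) : GradedModule H 𝒜 where
  carrier := M.carrier
  deg d := M.deg (n + d)
  isInternal := by
    obtain ⟨p, h1, h2, h3⟩ := exists_proj_of_isInternal M.isInternal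
    refine isInternal_of_proj _ (fun d => p (n + d)) (fun d => h1 _)
      (fun d e hde => h2 _ _ (by omega)) fun x => ?_
    have : ⨆ d, M.deg (n + d) = ⨆ d, M.deg d :=
      (Equiv.addLeft n).iSup_comp (g := M.deg)
    rw [this]
    exact h3 x
  smul_mem k d x m hx hm := by
    have := M.smul_mem k (n + d) x m hx hm
    rwa [show (k : ℤ) + (n + d) = n + (k + d) by ring] at this

/-- The direct sum of a finite family of graded modules. -/
def directSum {κ : Type} [Finite κ] (M : κ → GradedModule H 𝒜) : GradedModule H 𝒜 where
  carrier := ∀ k, (M k).carrier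
  deg d := AddSubgroup.pi Set.univ fun k => (M k).deg d
  isInternal := by
    classical
    have := Fintype.ofFinite κ
    choose p h1 h2 h3 using fun k => exists_proj_of_isInternal (M k).isInternal
    refine isInternal_of_proj _
      (fun d => AddMonoidHom.mk' (fun f k => p k d (f k)) fun f g => by ext k; simp)
      (fun d f hf => ?_) (fun d e hde f hf => ?_) fun f => ?_
    · ext k
      exact h1 k d _ (hf k trivial)
    · ext k
      exact h2 k d e hde _ (hf k trivial)
    · rw [← Finset.univ_sum_single f]
      refine sum_mem fun k _ => ?_
      refine AddSubgroup.iSup_induction (C := fun x => Pi.single k x ∈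
        ⨆ d, AddSubgroup.pi Set.univ fun k => (M k).deg d) _ (h3 k (f k))
        (fun d x hx => ?_) ?_ fun x y hx hy => ?_
      · refine AddSubgroup.mem_iSup_of_mem d fun l _ => ?_
        by_cases h : l = k
        · subst h
          simpa using hx
        · simp [Pi.single_eq_of_ne h, zero_mem]
      · rw [Pi.single_zero]; exact zero_mem _
      · rw [Pi.single_add]; exact add_mem hx hy
  smul_mem n d x m hx hm k _ := (M k).smul_mem n d x (m k) hx (hm k trivial)

end GradedModule

end Modules

section Objects

variable {𝕜} [Module H A] [HModuleAlgebra 𝕜 H A] (𝒜 : ℕ → Submodule 𝕜 A)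
  (V : Type u) [AddCommGroup V] [Module 𝕜 V] [Module H V] [IsScalarTower 𝕜 H V]

theorem tmul_mem_range {S : Submodule 𝕜 A} {a : A} (ha : a ∈ S) {X : Type u} [AddCommGroup X]
    [Module 𝕜 X] (v : X) : a ⊗ₜ[𝕜] v ∈ LinearMap.range (S.subtype.rTensor X) :=
  ⟨⟨a, ha⟩ ⊗ₜ v, rfl⟩

theorem range_rTensor_induction {S : Submodule 𝕜 A} {X : Type u} [AddCommGroup X]
    [Module 𝕜 X] {C : A ⊗[𝕜] X → Prop} (h0 : C 0) (h1 : ∀ a ∈ S, ∀ v, C (a ⊗ₜ v))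
    (h2 : ∀ x y, C x → C y → C (x + y)) {x : A ⊗[𝕜] X}
    (hx : x ∈ LinearMap.range (S.subtype.rTensor X)) : C x := by
  obtain ⟨z, rfl⟩ := hx
  induction z using TensorProduct.induction_on with
  | zero => rwa [map_zero]
  | tmul a v => exact h1 _ a.2 v
  | add p q hp hq => rw [map_add]; exact h2 _ _ hp hq

/-- The grading of `A ⊗ V`, with `(A ⊗ V)_d = A_d ⊗ V` for `d ≥ 0` and `(A ⊗ V)_d = 0` for
`d < 0`. -/
def inducedDegree (d : ℤ) : Submodule 𝕜 (A ⊗[𝕜] V) :=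
  if 0 ≤ d then LinearMap.range ((𝒜 d.toNat).subtype.rTensor V) else ⊥

theorem inducedDegree_natCast (n : ℕ) :
    inducedDegree 𝒜 V n = LinearMap.range ((𝒜 n).subtype.rTensor V) := by
  simp [inducedDegree]

theorem inducedDegree_of_neg {d : ℤ} (hd : d < 0) : inducedDegree 𝒜 V d = ⊥ := by
  simp [inducedDegree, hd]

variable [GradedAlgebra 𝒜] [GradedAction H 𝒜]

theorem inducedDegree_isInternal :
    DirectSum.IsInternal fun d => (inducedDegree 𝒜 V d).toAddSubgroup := by
  refine isInternal_of_proj _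
    (fun d => if 0 ≤ d then ((GradedAlgebra.proj 𝒜 d.toNat).rTensor V).toAddMonoidHom else 0)
    (fun d x hx => ?_) (fun d e hde x hx => ?_) fun x => ?_
  · rcases lt_or_ge d 0 with hd | hd
    · have hx : x ∈ inducedDegree 𝒜 V d := hx
      rw [inducedDegree_of_neg 𝒜 V hd, Submodule.mem_bot] at hx
      rw [hx, map_zero]
    · obtain ⟨n, rfl⟩ := Int.eq_ofNat_of_zero_le hd
      have hx : x ∈ inducedDegree 𝒜 V n := hx
      rw [inducedDegree_natCast] at hx
      rw [if_pos hd]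
      change (GradedAlgebra.proj 𝒜 (n : ℤ).toNat).rTensor V x = x
      rw [Int.toNat_natCast]
      refine range_rTensor_induction
        (C := fun x => (GradedAlgebra.proj 𝒜 n).rTensor V x = x) (map_zero _) (fun a ha v => ?_)
        (fun x y h1 h2 => by rw [map_add, h1, h2]) hx
      rw [LinearMap.rTensor_tmul, GradedAlgebra.proj_apply, DirectSum.decompose_of_mem_same 𝒜 ha]
  · rcases lt_or_ge d 0 with hd | hd
    · have hx : x ∈ inducedDegree 𝒜 V d := hx
      rw [inducedDegree_of_neg 𝒜 V hd, Submodule.mem_bot] at hx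
      rw [hx, map_zero]
    · obtain ⟨n, rfl⟩ := Int.eq_ofNat_of_zero_le hd
      have hx : x ∈ inducedDegree 𝒜 V n := hx
      rw [inducedDegree_natCast] at hx
      split_ifs with he
      · change (GradedAlgebra.proj 𝒜 e.toNat).rTensor V x = 0
        refine range_rTensor_induction
          (C := fun x => (GradedAlgebra.proj 𝒜 e.toNat).rTensor V x = 0) (map_zero _)
          (fun a ha v => ?_) (fun x y h1 h2 => by rw [map_add, h1, h2, add_zero]) hx
        rw [LinearMap.rTensor_tmul, GradedAlgebra.proj_apply,
          DirectSum.decompose_of_mem_ne 𝒜 ha (by omega), TensorProduct.zero_tmul]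
      · rfl
  · induction x using TensorProduct.induction_on with
    | zero => exact zero_mem _
    | add p q hp hq => exact add_mem hp hq
    | tmul a v =>
      classical
      rw [← DirectSum.sum_support_decompose 𝒜 a, TensorProduct.sum_tmul]
      refine sum_mem fun n _ => AddSubgroup.mem_iSup_of_mem (n : ℤ) ?_
      change _ ∈ inducedDegree 𝒜 V n
      rw [inducedDegree_natCast]
      exact tmul_mem_range (SetLike.coe_mem _) v

theorem inducedDegree_smul_mem (n : ℕ) (d : ℤ) (x : A ⊗[𝕜] H) (m : A ⊗[𝕜] V)
    (hx : x ∈ LinearMap.range ((𝒜 n).subtype.rTensor H)) (hm : m ∈ inducedDegree 𝒜 V d) :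
    smashOp 𝕜 H A V x m ∈ inducedDegree 𝒜 V (n + d) := by
  rcases lt_or_ge d 0 with hd | hd
  · rw [inducedDegree_of_neg 𝒜 V hd, Submodule.mem_bot] at hm
    rw [hm, map_zero]
    exact zero_mem _
  · obtain ⟨k, rfl⟩ := Int.eq_ofNat_of_zero_le hd
    have hm : m ∈ inducedDegree 𝒜 V k := hm
    change _ ∈ inducedDegree 𝒜 V ((n : ℤ) + (k : ℤ))
    rw [inducedDegree_natCast] at hm
    rw [← Nat.cast_add, inducedDegree_natCast]
    refine range_rTensor_induction (C := fun x => smashOp 𝕜 H A V x m ∈ _)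
      (by rw [map_zero, LinearMap.zero_apply]; exact zero_mem _) (fun a ha h => ?_)
      (fun x y h1 h2 => by rw [map_add, LinearMap.add_apply]; exact add_mem h1 h2) hx
    refine range_rTensor_induction (C := fun m => smashOp 𝕜 H A V (a ⊗ₜ h) m ∈ _)
      (by rw [map_zero]; exact zero_mem _) (fun b hb v => ?_)
      (fun x y h1 h2 => by rw [map_add]; exact add_mem h1 h2) hm
    rw [smashOp_tmul_apply, diagAction_apply_repr 𝕜 H h (Coalgebra.Repr.arbitrary 𝕜 h), map_sum]
    refine sum_mem fun i _ => ?_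
    exact tmul_mem_range (SetLike.mul_mem_graded ha (GradedAction.smul_mem _ _ _ hb)) _

/-- The graded left `A # H`-module `A ⊗ V` with `(x # h)(a ⊗ v) = ∑ x h₁(a) ⊗ h₂ v` and
`(A ⊗ V)_d = A_d ⊗ V`. -/
def inducedModule : GradedModule H 𝒜 where
  carrier := DiagTensor 𝕜 A V
  deg d := (inducedDegree 𝒜 V d).toAddSubgroup
  isInternal := inducedDegree_isInternal 𝒜 V
  smul_mem n d x m hx hm := inducedDegree_smul_mem H 𝒜 V n d x m hx hm

theorem smashToHopf_of_mem [ConnectedGraded 𝒜] {n : ℕ} (hn : n ≠ 0) (x : SmashProduct 𝕜 H A)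
    (hx : x ∈ smashDegree H 𝒜 n) : smashToHopf H 𝒜 x = 0 := by
  refine range_rTensor_induction (C := fun x => smashToHopfAux H 𝒜 x = 0) (map_zero _)
    (fun a ha h => ?_) (fun x y h1 h2 => by rw [map_add, h1, h2, add_zero]) hx
  have z : augmentation 𝒜 a = 0 := by
    refine augmentation_eq_of 𝒜 ?_
    rw [map_zero]
    exact (DirectSum.decompose_of_mem_ne 𝒜 ha hn).symm
  rw [smashToHopfAux_tmul, z, zero_smul]

/-- The left `H`-module `V`, regarded as a left `A # H`-module through the surjection
`A # H → H` and concentrated in degree `0`. -/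
def inflatedModule [ConnectedGraded 𝒜] : GradedModule H 𝒜 where
  carrier := V
  module := Module.compHom V (smashToHopf H 𝒜)
  deg d := if d = 0 then ⊤ else ⊥
  isInternal := by
    refine isInternal_of_proj _ (fun d => if d = 0 then AddMonoidHom.id V else 0)
      (fun d x hx => ?_) (fun d e hde x hx => ?_) fun x => ?_
    · split_ifs at hx ⊢ with h
      · rfl
      · rw [AddSubgroup.mem_bot] at hx
        rw [hx, map_zero]
    · split_ifs at hx ⊢ with h h'
      · omega
      · rw [AddSubgroup.mem_bot] at hx
        rw [hx, map_zero]
      · rfl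
      · rfl
    · exact AddSubgroup.mem_iSup_of_mem 0 (by simp)
  smul_mem n d x m hx hm := by
    change smashToHopf H 𝒜 x • m ∈ _
    by_cases hn : n = 0
    · subst hn
      by_cases hd : d = 0
      · simp [hd]
      · rw [if_neg hd, AddSubgroup.mem_bot] at hm
        rw [hm, smul_zero]
        exact zero_mem _
    · rw [smashToHopf_of_mem H 𝒜 hn x hx, zero_smul]
      exact zero_mem _

end Objects

end Graded

section Quivers

/-- The vertex set of the directed graph with vertices indexed by `ι` and with `m i j` arrows from
the vertex `i` to the vertex `j`. -/
structure MultQuiver {ι : Type} (m : ι → ι → ℕ) : Type where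
  index : ι

instance {ι : Type} (m : ι → ι → ℕ) : Quiver (MultQuiver m) where
  Hom a b := Fin (m a.index b.index)

variable {𝕜 : Type u} [Field 𝕜] {H : Type u} [Ring H] [HopfAlgebra 𝕜 H]
  {A : Type u} [Ring A] [Algebra 𝕜 A] [Module H A] [HModuleAlgebra 𝕜 H A]
  {ι : Type} [Fintype ι] (V : ι → Type u) [∀ i, AddCommGroup (V i)] [∀ i, Module 𝕜 (V i)]
  [∀ i, Module H (V i)] [∀ i, IsScalarTower 𝕜 H (V i)]

/-- `m i j` is the multiplicity of `P⁽ⁱ⁾[-1]`, where `P⁽ⁱ⁾ = A ⊗ V⁽ⁱ⁾`, in the first term of the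
minimal projective resolution `R j` of the `A # H`-module `V⁽ʲ⁾`; that is, this first term is
isomorphic to `⨁ᵢ (P⁽ⁱ⁾[-1])^{m i j}`. These are the numbers of arrows in the Gabriel quiver. -/
def IsGabrielMatrix (𝒜 : ℕ → Submodule 𝕜 A) [GradedAlgebra 𝒜] [ConnectedGraded 𝒜]
    [GradedAction H 𝒜]
    (R : ∀ j, GradedModule.MinimalResolution (inflatedModule H 𝒜 (V j)))
    (m : ι → ι → ℕ) : Prop :=
  ∀ j, GradedModule.Isomorphic ((R j).Q 1)
    (GradedModule.directSum fun x : Σ i, Fin (m i j) => (inducedModule H 𝒜 (V x.1)).shift (-1))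

variable (𝕜 H) in
/-- `n i j` are the fusion coefficients: `W ⊗ V⁽ʲ⁾ ≅ ⨁ᵢ (V⁽ⁱ⁾)^{n i j}` as left `H`-modules. These
are the numbers of arrows in the McKay quiver. -/
def IsMcKayMatrix (W : Type u) [AddCommGroup W] [Module 𝕜 W] [Module H W] [IsScalarTower 𝕜 H W]
    (n : ι → ι → ℕ) : Prop :=
  ∀ j, Nonempty (DiagTensor 𝕜 W (V j) ≃ₗ[H] (∀ x : Σ i, Fin (n i j), V x.1))

end Quivers

end HopfMcKay

end

/-! Everything rests on one computation: the first term of the minimal resolution of an `H`-module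
`V` is `A ⊗ (W ⊗ V)` shifted by `-1`.

Let `J` be the kernel of `A # H → H`. Because `A₀ = 𝕜`, it is spanned by the `a # h` with `a`
homogeneous of positive degree, so `J` plays the part of a graded radical: a Nakayama lemma
(`nakayama`) holds for graded modules that are bounded below. The functor `A ⊗ -` is left adjoint to
restriction from `A # H` to `H` (`extend`). Over the semisimple `H` every `V` is projective, hence
so is `A ⊗ V`, and by Nakayama `A ⊗ V → V`, `a ⊗ v ↦ ε(a) v`, is a projective cover
(`isProjectiveCover_counitMap`).

Its kernel is `Ω = A₊ ⊗ V`, where `A₊` is the augmentation ideal. As `W` generates `A`, the left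
ideal generated by `W` is `A₊` (`sub_augmentation_mem_span`), so `W ⊗ V`, inside `A₁ ⊗ V`, generates
`Ω`. None of these generators is redundant: `Ω` starts in degree `1`, so `J Ω` starts in degree `2`
(`proj_one_eq_zero`). Hence a decomposition of `W ⊗ V` into simple modules `V⁽ⁱ⁾` gives a projective
cover of `Ω` by the corresponding modules `(A ⊗ V⁽ⁱ⁾)[-1]` (`exists_cover_ker_counitMap`). Graded
projective covers are unique up to isomorphism, so every McKay matrix is a Gabriel matrix for every
choice of resolutions.

Conversely the matrices are determined by the modules. The degree `1` component of `(A ⊗ V⁽ⁱ⁾)[-1]`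
is `V⁽ⁱ⁾`, which reduces both cases to the multiplicities of simple `H`-modules. These are counted
by dimensions of Hom spaces (`multiplicity_unique`), which are finite since a semisimple Hopf
algebra is finite-dimensional. The two matrices therefore coincide, and the identity on indices is
the isomorphism of quivers. -/

noncomputable section

namespace HopfMcKay

/-! ### Finite-dimensionality of semisimple Hopf algebras, by means of integrals. -/

section FiniteDimensional

variable (𝕜 : Type u) [Field 𝕜] (H : Type u) [Ring H] [HopfAlgebra 𝕜 H]

/-- A semisimple Hopf algebra has a left integral of counit `1`. -/
theorem exists_integral [IsSemisimpleRing H] :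
    ∃ Λ : H, Coalgebra.counit (R := 𝕜) Λ = 1 ∧
      ∀ h : H, h * Λ = Coalgebra.counit (R := 𝕜) h • Λ := by
  -- The augmentation ideal has a complementary left ideal by semisimplicity; the integral is the
  -- component of `1` in it.
  let K : Submodule H H := RingHom.ker (Bialgebra.counitAlgHom 𝕜 H)
  have hK : ∀ x, x ∈ K ↔ Coalgebra.counit (R := 𝕜) x = 0 := fun x => Iff.rfl
  obtain ⟨I, hI⟩ := exists_isCompl K
  have h1 : (1 : H) ∈ K ⊔ I := by rw [hI.sup_eq_top]; trivial
  obtain ⟨a, ha, Λ, hΛ, e⟩ := Submodule.mem_sup.1 h1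
  have c : Coalgebra.counit (R := 𝕜) Λ = 1 := by
    have := congrArg (Coalgebra.counit (R := 𝕜)) e
    rwa [map_add, (hK a).1 ha, zero_add, Bialgebra.counit_one] at this
  refine ⟨Λ, c, fun h => sub_eq_zero.1 ?_⟩
  -- The difference `hΛ - ε(h)Λ` lies in the complement `I`, and it has counit zero because `ε(Λ) =
  -- 1`.
  refine Submodule.disjoint_def.1 hI.disjoint _ ?_ (sub_mem (I.smul_mem h hΛ) ?_)
  · rw [hK, map_sub, Bialgebra.counit_mul, map_smul, c]
    simp
  · rw [← one_mul Λ, ← smul_mul_assoc]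
    exact I.smul_mem _ hΛ

variable {𝕜 H} in
/-- For a left integral `Λ` one has `∑ Λ₁ ⊗ h Λ₂ = ∑ S(h) Λ₁ ⊗ Λ₂`. -/
theorem one_tmul_mul_comul_integral {Λ : H}
    (hΛ : ∀ h : H, h * Λ = Coalgebra.counit (R := 𝕜) h • Λ) (h : H) :
    ((1 : H) ⊗ₜ[𝕜] h) * Coalgebra.comul Λ =
      (HopfAlgebra.antipode 𝕜 h ⊗ₜ[𝕜] (1 : H)) * Coalgebra.comul Λ := by
  set t : H ⊗[𝕜] H := Coalgebra.comul Λ with ht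
  have hy : ∀ y : H, Coalgebra.comul y * t = Coalgebra.counit (R := 𝕜) y • t := by
    intro y
    rw [ht, ← Bialgebra.comul_mul, hΛ, map_smul]
  -- `F (x ⊗ p ⊗ q) = (S(x) p ⊗ q) Δ(Λ)`. On `∑ h₁ ⊗ h₂ ⊗ h₃` it can be evaluated in two ways:
  -- `Δ(h₂) Δ(Λ) = ε(h₂) Δ(Λ)` leaves `(S(h) ⊗ 1) Δ(Λ)`, and `∑ S(h₁) h₂ = ε(h)` leaves `(1 ⊗ h)
  -- Δ(Λ)`. Coassociativity identifies the two.
  let F : H ⊗[𝕜] (H ⊗[𝕜] H) →ₗ[𝕜] H ⊗[𝕜] H := LinearMap.mulRight 𝕜 t ∘ₗ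
    (LinearMap.mul' 𝕜 H).rTensor H ∘ₗ (TensorProduct.assoc 𝕜 H H H).symm.toLinearMap ∘ₗ
      (HopfAlgebra.antipode 𝕜).rTensor (H ⊗[𝕜] H)
  have h1 : ∀ z : H ⊗[𝕜] H, F (Coalgebra.comul.lTensor H z) =
      (HopfAlgebra.antipode 𝕜 (TensorProduct.rid 𝕜 H (Coalgebra.counit.lTensor H z)) ⊗ₜ[𝕜]
        (1 : H)) * t := by
    intro z
    induction z using TensorProduct.induction_on with
    | zero => simp
    | add p q hp hq => simp only [map_add, hp, hq, TensorProduct.add_tmul, add_mul]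
    | tmul x y =>
      have : ∀ s : H ⊗[𝕜] H, F (x ⊗ₜ s) =
          (HopfAlgebra.antipode 𝕜 x ⊗ₜ[𝕜] (1 : H)) * (s * t) := by
        intro s
        induction s using TensorProduct.induction_on with
        | zero => simp
        | add p q hp hq => rw [TensorProduct.tmul_add, map_add, hp, hq, add_mul, mul_add]
        | tmul p q => simp [F, ← mul_assoc]
      rw [LinearMap.lTensor_tmul, this, hy]
      simp [← smul_mul_assoc, TensorProduct.smul_tmul']
  have h2 : ∀ z : H ⊗[𝕜] H,
      F (TensorProduct.assoc 𝕜 H H H (Coalgebra.comul.rTensor H z)) =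
      ((1 : H) ⊗ₜ[𝕜] (TensorProduct.lid 𝕜 H (Coalgebra.counit.rTensor H z))) * t := by
    intro z
    induction z using TensorProduct.induction_on with
    | zero => simp
    | add p q hp hq => simp only [map_add, hp, hq, TensorProduct.tmul_add, add_mul]
    | tmul x y =>
      have : ∀ s : H ⊗[𝕜] H, F (TensorProduct.assoc 𝕜 H H H (s ⊗ₜ y)) =
          (LinearMap.mul' 𝕜 H ((HopfAlgebra.antipode 𝕜).rTensor H s) ⊗ₜ[𝕜] y) * t := by
        intro s
        induction s using TensorProduct.induction_on with
        | zero => simp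
        | add p q hp hq => simp only [TensorProduct.add_tmul, map_add, hp, hq, add_mul]
        | tmul p q => simp [F]
      rw [LinearMap.rTensor_tmul, this, HopfAlgebra.mul_antipode_rTensor_comul_apply]
      simp [Algebra.algebraMap_eq_smul_one, TensorProduct.smul_tmul]
  have e := (h2 (Coalgebra.comul h)).symm.trans
    ((congrArg F (Coalgebra.coassoc_apply h)).trans (h1 (Coalgebra.comul h)))
  simpa using e

/-- A semisimple Hopf algebra over a field is finite-dimensional. -/
theorem finite_of_isSemisimpleRing [IsSemisimpleRing H] : Module.Finite 𝕜 H := by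
  classical
  obtain ⟨Λ, hc, hΛ⟩ := exists_integral 𝕜 H
  let B := Module.Basis.ofVectorSpace 𝕜 H
  obtain ⟨b, hb⟩ := TensorProduct.eq_repr_basis_left B (Coalgebra.comul (R := 𝕜) Λ)
  rw [Finsupp.sum] at hb
  -- With `Δ(Λ) = ∑ Bᵢ ⊗ bᵢ`, a finite sum, the span of the `bᵢ` turns out to be all of `H`.
  let J := Submodule.span 𝕜 ((b.support.image b : Finset H) : Set H)
  have hbJ : ∀ i ∈ b.support, b i ∈ J := fun i hi =>
    Submodule.subset_span (Finset.mem_coe.2 (Finset.mem_image_of_mem _ hi))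
  -- Applying the `k`-th coordinate functional to the left factor of `(1 ⊗ x) Δ(Λ) = (S(x) ⊗ 1)
  -- Δ(Λ)` leaves `x bₖ` on one side and a combination of the `bᵢ` on the other.
  have hJ : ∀ x : H, ∀ k ∈ b.support, x * b k ∈ J := by
    intro x k hk
    have e := congrArg (fun z => TensorProduct.lid 𝕜 H ((B.coord k).rTensor H z))
      (one_tmul_mul_comul_integral hΛ x)
    simp only [← hb, Finset.mul_sum, map_sum, Algebra.TensorProduct.tmul_mul_tmul, one_mul,
      LinearMap.rTensor_tmul, TensorProduct.lid_tmul, Module.Basis.coord_apply,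
      Module.Basis.repr_self] at e
    rw [Finset.sum_eq_single k (fun i _ hik => by simp [Finsupp.single_eq_of_ne hik.symm])
      (fun h => (h hk).elim)] at e
    simp only [Finsupp.single_eq_same, one_smul] at e
    rw [e]
    exact sum_mem fun i hi => J.smul_mem _ (hbJ i hi)
  -- The antipode axiom at `Λ`, with `ε(Λ) = 1`. It writes any `h` as `∑ (h S(Bᵢ)) bᵢ`, which `hJ`
  -- places in the span.
  have h1 : ∑ i ∈ b.support, HopfAlgebra.antipode 𝕜 (B i) * b i = 1 := by
    have := HopfAlgebra.mul_antipode_rTensor_comul_apply (R := 𝕜) Λ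
    rw [← hb, hc, map_one] at this
    simpa using this
  have top : J = ⊤ := by
    rw [eq_top_iff]
    rintro h -
    rw [← mul_one h, ← h1, Finset.mul_sum]
    refine sum_mem fun i hi => ?_
    rw [← mul_assoc]
    exact hJ _ i hi
  exact ⟨⟨_, top⟩⟩

/-- Simple modules over a semisimple Hopf algebra are finite-dimensional. -/
theorem finite_of_isSimpleModule [IsSemisimpleRing H] (V : Type u) [AddCommGroup V] [Module 𝕜 V]
    [Module H V] [IsScalarTower 𝕜 H V] [IsSimpleModule H V] : Module.Finite 𝕜 V := by
  have := finite_of_isSemisimpleRing 𝕜 H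
  have := IsSimpleModule.nontrivial H V
  obtain ⟨v, hv⟩ := exists_ne (0 : V)
  exact Module.Finite.of_surjective ((LinearMap.toSpanSingleton H V v).restrictScalars 𝕜)
    (IsSimpleModule.toSpanSingleton_surjective H hv)

end FiniteDimensional

/-! ### Multiplicities of simple modules in finite direct sums. -/

section Multiplicities

variable {𝕜 : Type u} [Field 𝕜] {H : Type u} [Ring H] [Algebra 𝕜 H] {ι : Type} [Fintype ι]
  {V : ι → Type u} [∀ i, AddCommGroup (V i)] [∀ i, Module 𝕜 (V i)]
  [∀ i, Module H (V i)] [∀ i, IsScalarTower 𝕜 H (V i)]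

/-- The multiplicities of pairwise nonisomorphic finite-dimensional simple modules in a finite
direct sum are unique. -/
theorem multiplicity_unique [∀ i, Module.Finite 𝕜 (V i)] (hsimple : ∀ i, IsSimpleModule H (V i))
    (hdistinct : ∀ i j, Nonempty (V i ≃ₗ[H] V j) → i = j) {m n : ι → ℕ}
    (e : (∀ x : Σ i, Fin (m i), V x.1) ≃ₗ[H] (∀ x : Σ i, Fin (n i), V x.1)) : m = n := by
  classical
  have fin : ∀ i j, Module.Finite 𝕜 (V i →ₗ[H] V j) := fun i j =>
    Module.Finite.of_injective (LinearMap.restrictScalarsₗ 𝕜 H (V i) (V j) 𝕜)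
      (LinearMap.restrictScalars_injective 𝕜)
  have zero : ∀ i j, i ≠ j → Module.finrank 𝕜 (V i →ₗ[H] V j) = 0 := by
    intro i j hij
    have : Subsingleton (V i →ₗ[H] V j) := by
      refine subsingleton_of_forall_eq 0 fun f => ?_
      rcases LinearMap.bijective_or_eq_zero f with hf | hf
      · exact (hij (hdistinct i j ⟨LinearEquiv.ofBijective f hf⟩)).elim
      · exact hf
    exact Module.finrank_zero_of_subsingleton
  -- The dimension of `End V i` need not be known: it is a common nonzero factor that cancels at the
  -- end.
  have pos : ∀ i, 0 < Module.finrank 𝕜 (V i →ₗ[H] V i) := by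
    intro i
    have := IsSimpleModule.nontrivial H (V i)
    have : Nontrivial (V i →ₗ[H] V i) := inferInstanceAs (Nontrivial (Module.End H (V i)))
    exact Module.finrank_pos
  have count : ∀ (k : ι → ℕ) (i : ι),
      Module.finrank 𝕜 (V i →ₗ[H] (∀ x : Σ i, Fin (k i), V x.1)) =
        k i * Module.finrank 𝕜 (V i →ₗ[H] V i) := by
    intro k i
    let E : (V i →ₗ[H] (∀ x : Σ i, Fin (k i), V x.1)) ≃ₗ[𝕜]
        (∀ x : Σ i, Fin (k i), (V i →ₗ[H] V x.1)) :=
      { toFun := fun f x => LinearMap.proj x ∘ₗ f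
        invFun := LinearMap.pi
        map_add' := fun f g => rfl
        map_smul' := fun c f => rfl
        left_inv := fun f => rfl
        right_inv := fun f => rfl }
    rw [E.finrank_eq, Module.finrank_pi_fintype, Fintype.sum_sigma]
    rw [Finset.sum_eq_single i (fun j _ hj => Finset.sum_eq_zero fun _ _ => zero i j hj.symm)
      fun h => (h (Finset.mem_univ i)).elim]
    simp
  funext i
  have E : (V i →ₗ[H] (∀ x : Σ i, Fin (m i), V x.1)) ≃ₗ[𝕜]
      (V i →ₗ[H] (∀ x : Σ i, Fin (n i), V x.1)) :=
    { toFun := fun f => e.toLinearMap ∘ₗ f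
      invFun := fun f => e.symm.toLinearMap ∘ₗ f
      map_add' := fun f g => by ext; simp
      map_smul' := fun c f => by
        ext1 v
        exact (e.toLinearMap.restrictScalars 𝕜).map_smul c (f v)
      left_inv := fun f => by ext; simp
      right_inv := fun f => by ext; simp }
  have := E.finrank_eq
  rw [count, count] at this
  exact Nat.eq_of_mul_eq_mul_right (pos i) this

/-- A finite module over a semisimple ring is a direct sum of members of a complete list of simple
modules. -/
theorem exists_multiplicity {H : Type u} [Ring H] [IsSemisimpleRing H] {ι : Type}
    {V : ι → Type u} [∀ i, AddCommGroup (V i)] [∀ i, Module H (V i)]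
    (hcomplete : ∀ (S : Type u) [AddCommGroup S] [Module H S],
      IsSimpleModule H S → ∃ i, Nonempty (S ≃ₗ[H] V i))
    (M : Type u) [AddCommGroup M] [Module H M] [Module.Finite H M] :
    ∃ n : ι → ℕ, Nonempty (M ≃ₗ[H] (∀ x : Σ i, Fin (n i), V x.1)) := by
  classical
  obtain ⟨N, S, e, hS⟩ := IsSemisimpleModule.exists_linearEquiv_fin_dfinsupp H M
  choose c hc using fun k => hcomplete (S k) (hS k)
  let f : ∀ k, S k ≃ₗ[H] V (c k) := fun k => (hc k).some
  -- The multiplicity of `V i` is the number of summands `S k` whose chosen index `c k` is `i`; `r`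
  -- regroups the summands along the fibres of `c`.
  let r : (Σ i, Fin (Fintype.card {k // c k = i})) ≃ Fin N :=
    (Equiv.sigmaCongrRight fun i => (Fintype.equivFin _).symm).trans (Equiv.sigmaFiberEquiv c)
  have hr : ∀ x, c (r x) = x.1 := fun x => ((Fintype.equivFin _).symm x.2).2
  -- The equality `c (r x) = x.1` is only propositional, so the modules on its two sides are matched
  -- by an isomorphism.
  have cast : ∀ i j, i = j → Nonempty (V i ≃ₗ[H] V j) := by
    rintro i _ rfl
    exact ⟨LinearEquiv.refl _ _⟩
  let e₁ : M ≃ₗ[H] ∀ k, S k := e.trans (DFinsupp.linearEquivFunOnFintype (R := H))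
  let e₂ : (∀ k, S k) ≃ₗ[H] ∀ k, V (c k) := LinearEquiv.piCongrRight f
  let e₃ : (∀ x, V (c (r x))) ≃ₗ[H] ∀ k, V (c k) := LinearEquiv.piCongrLeft H (fun k => V (c k)) r
  let e₄ : (∀ x, V (c (r x))) ≃ₗ[H] (∀ x : Σ i, Fin (Fintype.card {k // c k = i}), V x.1) :=
    LinearEquiv.piCongrRight fun x => (cast _ _ (hr x)).some
  exact ⟨_, ⟨e₁.trans (e₂.trans (e₃.symm.trans e₄))⟩⟩

end Multiplicities

/-- Scalars act on `M ⊗ N` in the usual way. This instance takes precedence over the (equal)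
diagonal action of the Hopf algebra `𝕜`. -/
instance DiagTensor.instModuleScalar (𝕜 : Type u) [Field 𝕜] (M N : Type u) [AddCommGroup M]
    [Module 𝕜 M] [AddCommGroup N] [Module 𝕜 N] : Module 𝕜 (DiagTensor 𝕜 M N) :=
  inferInstanceAs (Module 𝕜 (M ⊗[𝕜] N))

/-! ### Modules over the smash product, and induction from `H` to `A # H`. -/

section SmashModules

variable {𝕜 : Type u} [Field 𝕜] {H : Type u} [Ring H] [HopfAlgebra 𝕜 H]
  {A : Type u} [Ring A] [Algebra 𝕜 A] [Module H A] [HModuleAlgebra 𝕜 H A]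

namespace SmashProduct

theorem induction {C : SmashProduct 𝕜 H A → Prop} (zero : C 0) (mk : ∀ a h, C (mk a h))
    (add : ∀ x y, C x → C y → C (x + y)) (x : SmashProduct 𝕜 H A) : C x :=
  TensorProduct.induction_on x zero mk add

theorem smul_mul_eq (c : 𝕜) (x y : SmashProduct 𝕜 H A) : c • x * y = c • (x * y) :=
  LinearMap.congr_fun (map_smul (smashOp 𝕜 H A H) c x) y

theorem mul_smul_eq (c : 𝕜) (x y : SmashProduct 𝕜 H A) : x * c • y = c • (x * y) :=
  map_smul (smashOp 𝕜 H A H x) c y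

theorem mk_one_mul_mk (a b : A) (h : H) :
    (mk a 1 * mk b h : SmashProduct 𝕜 H A) = mk (a * b) h := by
  change smashOp 𝕜 H A H (a ⊗ₜ 1) (b ⊗ₜ h) = (a * b) ⊗ₜ h
  rw [smashOp_tmul_apply, map_one]
  rfl

theorem mk_mul_mk_one_left (a : A) (h g : H) :
    (mk a h * mk 1 g : SmashProduct 𝕜 H A) = mk a (h * g) := by
  have e : ∀ t : H ⊗[𝕜] H, (LinearMap.mulLeft 𝕜 a).rTensor H (TensorProduct.map
      ((LinearMap.toSpanSingleton H A (1 : A)).restrictScalars 𝕜)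
      ((LinearMap.toSpanSingleton H H g).restrictScalars 𝕜) t) =
      a ⊗ₜ (TensorProduct.lid 𝕜 H (Coalgebra.counit.rTensor H t) * g) := by
    intro t
    induction t using TensorProduct.induction_on with
    | zero => simp
    | tmul x y =>
      simp [HModuleAlgebra.smul_one (𝕜 := 𝕜), Algebra.algebraMap_eq_smul_one,
        TensorProduct.smul_tmul]
    | add p q hp hq => simp only [map_add, TensorProduct.tmul_add, add_mul, hp, hq]
  change smashOp 𝕜 H A H (a ⊗ₜ h) (1 ⊗ₜ g) = a ⊗ₜ (h * g)
  rw [smashOp_tmul_apply, diagAction_apply_tmul, e, Coalgebra.rTensor_counit_comul]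
  simp

theorem mk_eq (a : A) (h : H) : (mk a h : SmashProduct 𝕜 H A) = mk a 1 * mk 1 h := by
  rw [mk_one_mul_mk, mul_one]

theorem mk_add_left (a b : A) (h : H) : (mk (a + b) h : SmashProduct 𝕜 H A) = mk a h + mk b h :=
  TensorProduct.add_tmul a b h

theorem mk_add_right (a : A) (h g : H) : (mk a (h + g) : SmashProduct 𝕜 H A) = mk a h + mk a g :=
  TensorProduct.tmul_add a h g

theorem mk_smul_left (c : 𝕜) (a : A) (h : H) :
    (mk (c • a) h : SmashProduct 𝕜 H A) = c • mk a h := rfl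

theorem mk_smul_right (c : 𝕜) (a : A) (h : H) :
    (mk a (c • h) : SmashProduct 𝕜 H A) = c • mk a h :=
  TensorProduct.tmul_smul c a h

variable (𝕜 H A) in
/-- The inclusion `H → A # H`, `h ↦ 1 # h`. -/
def ofHopf : H →+* SmashProduct 𝕜 H A where
  toFun h := mk 1 h
  map_one' := rfl
  map_mul' h g := (mk_mul_mk_one_left 1 h g).symm
  map_zero' := TensorProduct.tmul_zero _ _
  map_add' h g := mk_add_right 1 h g

end SmashProduct

variable (𝕜 H A) in
/-- The actions of `𝕜` and `H` on `M` are induced by the action of `A # H`. -/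
class SmashTower (M : Type u) [AddCommGroup M] [Module 𝕜 M] [Module H M]
    [Module (SmashProduct 𝕜 H A) M] : Prop extends IsScalarTower 𝕜 H M where
  mk_one_smul : ∀ (h : H) (m : M), (SmashProduct.mk 1 h : SmashProduct 𝕜 H A) • m = h • m

variable (𝕜 H A) in
/-- The `H`-module underlying an `A # H`-module. -/
abbrev hopfModule (M : Type u) [AddCommGroup M] [Module (SmashProduct 𝕜 H A) M] : Module H M :=
  Module.compHom M (SmashProduct.ofHopf 𝕜 H A)

variable (𝕜 H A) in
/-- The vector space underlying an `A # H`-module. -/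
abbrev scalarModule (M : Type u) [AddCommGroup M] [Module (SmashProduct 𝕜 H A) M] : Module 𝕜 M :=
  Module.compHom M ((SmashProduct.ofHopf 𝕜 H A).comp (algebraMap 𝕜 H))

/-- Restriction along `h ↦ 1 # h` makes the adjunction between induction and restriction available
for a module that is only given over `A # H`. -/
theorem smashTower_hopfModule (M : Type u) [AddCommGroup M] [Module (SmashProduct 𝕜 H A) M] :
    letI := scalarModule 𝕜 H A M
    letI := hopfModule 𝕜 H A M
    SmashTower 𝕜 H A M :=
  letI := scalarModule 𝕜 H A M
  letI := hopfModule 𝕜 H A M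
  { smul_assoc := fun c h m => by
      change SmashProduct.ofHopf 𝕜 H A (c • h) • m =
        SmashProduct.ofHopf 𝕜 H A (algebraMap 𝕜 H c) • SmashProduct.ofHopf 𝕜 H A h • m
      rw [← mul_smul, ← map_mul, Algebra.smul_def]
    mk_one_smul := fun h m => rfl }

section Tower

variable {M : Type u} [AddCommGroup M] [Module 𝕜 M] [Module H M]
  [Module (SmashProduct 𝕜 H A) M] [SmashTower 𝕜 H A M]

/-- A scalar `c` acts as the element `1 # c1`, which is central in `A # H`; this lemma and the next
express the two sides of that fact. -/
theorem smashTower_smul_assoc (c : 𝕜) (x : SmashProduct 𝕜 H A) (m : M) :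
    (c • x) • m = c • x • m := by
  have e : c • x = SmashProduct.mk 1 (algebraMap 𝕜 H c) * x := by
    rw [Algebra.algebraMap_eq_smul_one, SmashProduct.mk_smul_right, SmashProduct.smul_mul_eq]
    exact congrArg (c • ·) (one_mul x).symm
  rw [e, mul_smul, SmashTower.mk_one_smul, algebraMap_smul]

theorem smashTower_smul_comm (c : 𝕜) (x : SmashProduct 𝕜 H A) (m : M) :
    x • c • m = c • x • m := by
  have e : c • x = x * SmashProduct.mk 1 (algebraMap 𝕜 H c) := by
    rw [Algebra.algebraMap_eq_smul_one, SmashProduct.mk_smul_right, SmashProduct.mul_smul_eq]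
    exact congrArg (c • ·) (mul_one x).symm
  rw [← smashTower_smul_assoc, e, mul_smul, SmashTower.mk_one_smul, algebraMap_smul]

variable {N : Type u} [AddCommGroup N] [Module 𝕜 N] [Module H N]
  [Module (SmashProduct 𝕜 H A) N] [SmashTower 𝕜 H A N]

/-- An `A # H`-linear map is `H`-linear. -/
def hopfLinear (f : M →ₗ[SmashProduct 𝕜 H A] N) : M →ₗ[H] N where
  toFun := f
  map_add' := map_add f
  map_smul' h m := by
    rw [← SmashTower.mk_one_smul (𝕜 := 𝕜) (A := A), map_smul,
      SmashTower.mk_one_smul (𝕜 := 𝕜) (A := A)]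
    rfl

end Tower

variable {V : Type u} [AddCommGroup V] [Module 𝕜 V] [Module H V] [IsScalarTower 𝕜 H V]

theorem DiagTensor.induction {X Y : Type u} [AddCommGroup X] [Module 𝕜 X] [AddCommGroup Y]
    [Module 𝕜 Y] {C : DiagTensor 𝕜 X Y → Prop} (zero : C 0) (mk : ∀ a v, C (mk 𝕜 a v))
    (add : ∀ x y, C x → C y → C (x + y)) (x : DiagTensor 𝕜 X Y) : C x :=
  TensorProduct.induction_on x zero mk add

instance {X Y : Type u} [AddCommGroup X] [Module 𝕜 X] [Module H X] [IsScalarTower 𝕜 H X]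
    [AddCommGroup Y] [Module 𝕜 Y] [Module H Y] [IsScalarTower 𝕜 H Y] :
    IsScalarTower 𝕜 H (DiagTensor 𝕜 X Y) where
  smul_assoc c h m := by
    have e : ∀ m : X ⊗[𝕜] Y, diagAction 𝕜 H X Y (c • h) m = c • diagAction 𝕜 H X Y h m := by
      intro m
      rw [map_smul, LinearMap.smul_apply]
    exact e m

theorem smashOp_one_tmul (h : H) (m : A ⊗[𝕜] V) :
    smashOp 𝕜 H A V (1 ⊗ₜ h) m = diagAction 𝕜 H A V h m := by
  rw [smashOp_tmul_apply, LinearMap.mulLeft_one, LinearMap.rTensor_id, LinearMap.id_apply]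

instance : SmashTower 𝕜 H A (DiagTensor 𝕜 A V) where
  mk_one_smul h m := smashOp_one_tmul h m

theorem SmashProduct.mk_one_smul_mk (a b : A) (v : V) :
    (SmashProduct.mk a 1 : SmashProduct 𝕜 H A) • DiagTensor.mk 𝕜 b v =
      DiagTensor.mk 𝕜 (a * b) v := by
  change smashOp 𝕜 H A V (a ⊗ₜ 1) (b ⊗ₜ v) = (a * b) ⊗ₜ v
  rw [smashOp_tmul_apply, map_one]
  rfl

variable (𝕜 H A V) in
/-- The map `V → A ⊗ V`, `v ↦ 1 ⊗ v`. -/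
def unitMap : V →ₗ[H] DiagTensor 𝕜 A V where
  toFun v := DiagTensor.mk 𝕜 1 v
  map_add' v w := TensorProduct.tmul_add 1 v w
  map_smul' h v := by
    have e : ∀ t : H ⊗[𝕜] H, TensorProduct.map
        ((LinearMap.toSpanSingleton H A (1 : A)).restrictScalars 𝕜)
        ((LinearMap.toSpanSingleton H V v).restrictScalars 𝕜) t =
        1 ⊗ₜ (TensorProduct.lid 𝕜 H (Coalgebra.counit.rTensor H t) • v) := by
      intro t
      induction t using TensorProduct.induction_on with
      | zero => simp
      | tmul x y =>
        simp [HModuleAlgebra.smul_one (𝕜 := 𝕜), Algebra.algebraMap_eq_smul_one,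
          TensorProduct.smul_tmul]
      | add p q hp hq => simp only [map_add, TensorProduct.tmul_add, add_smul, hp, hq]
    change (1 : A) ⊗ₜ (h • v) = diagAction 𝕜 H A V h (1 ⊗ₜ v)
    rw [diagAction_apply_tmul, e, Coalgebra.rTensor_counit_comul]
    simp

theorem unitMap_apply (v : V) : unitMap 𝕜 H A V v = DiagTensor.mk 𝕜 1 v := rfl

theorem mk_smul_unitMap (a : A) (v : V) :
    (SmashProduct.mk a 1 : SmashProduct 𝕜 H A) • unitMap 𝕜 H A V v = DiagTensor.mk 𝕜 a v := by
  rw [unitMap_apply, SmashProduct.mk_one_smul_mk, mul_one]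

section Extend

variable {N : Type u} [AddCommGroup N] [Module 𝕜 N] [Module H N]
  [Module (SmashProduct 𝕜 H A) N] [SmashTower 𝕜 H A N]

/-- The `𝕜`-linear map `A ⊗ V → N`, `a ⊗ v ↦ (a # 1) f(v)`. -/
def extendAux (f : V →ₗ[H] N) : A ⊗[𝕜] V →ₗ[𝕜] N :=
  TensorProduct.lift (LinearMap.mk₂ 𝕜
    (fun a v => (SmashProduct.mk a 1 : SmashProduct 𝕜 H A) • f v)
    (fun a b v => by rw [SmashProduct.mk_add_left, add_smul])
    (fun c a v => by rw [SmashProduct.mk_smul_left, smashTower_smul_assoc])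
    (fun a v w => by rw [map_add, smul_add])
    (fun c a v => by
      rw [← smashTower_smul_comm]
      exact congrArg _ ((f.restrictScalars 𝕜).map_smul c v)))

/-- The `A # H`-linear extension `A ⊗ V → N` of an `H`-linear map `f : V → N`. -/
def extend (f : V →ₗ[H] N) : DiagTensor 𝕜 A V →ₗ[SmashProduct 𝕜 H A] N where
  toFun := extendAux f
  map_add' := map_add (extendAux f)
  map_smul' x m := by
    have mk : ∀ (a : A) (v : V), extendAux f (DiagTensor.mk 𝕜 a v : DiagTensor 𝕜 A V) =
      (SmashProduct.mk a 1 : SmashProduct 𝕜 H A) • f v := fun a v => rfl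
    rw [RingHom.id_apply]
    induction x using SmashProduct.induction with
    | zero => rw [zero_smul, zero_smul]; exact map_zero (extendAux f)
    | add x y hx hy =>
      rw [add_smul, add_smul, ← hx, ← hy]
      exact map_add (extendAux f) _ _
    | mk x h =>
      induction m using DiagTensor.induction with
      | zero =>
        have z : extendAux f (0 : DiagTensor 𝕜 A V) = 0 := map_zero (extendAux f)
        rw [smul_zero, z, smul_zero]
      | add p q hp hq =>
        have e : ∀ p q : DiagTensor 𝕜 A V,
          extendAux f (p + q) = extendAux f p + extendAux f q := map_add (extendAux f)
        rw [smul_add, e, e, smul_add, hp, hq]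
      | mk a v =>
        -- Both sides become `∑ (x h₁(a) # 1) f(h₂ v)`: on the right, `(x # h)(a # 1) = ∑ (x h₁(a) #
        -- 1)(1 # h₂)`, and `f` is `H`-linear.
        let r := Coalgebra.Repr.arbitrary 𝕜 h
        rw [SmashProduct.mk_smul_tmul x a h v r, mk, ← mul_smul, SmashProduct.mk_mul_mk x a h 1 r,
          Finset.sum_smul]
        refine (map_sum (extendAux f) _ _).trans (Finset.sum_congr rfl fun i _ => ?_)
        rw [mul_one, SmashProduct.mk_eq, mul_smul, SmashTower.mk_one_smul, ← map_smul]
        exact mk _ _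

theorem extend_mk (f : V →ₗ[H] N) (a : A) (v : V) :
    extend f (DiagTensor.mk 𝕜 a v) = (SmashProduct.mk a 1 : SmashProduct 𝕜 H A) • f v := rfl

theorem extend_unitMap (f : V →ₗ[H] N) (v : V) : extend f (unitMap 𝕜 H A V v) = f v :=
  (extend_mk f 1 v).trans (one_smul _ _)

end Extend

theorem induced_hom_ext {N : Type u} [AddCommGroup N] [Module (SmashProduct 𝕜 H A) N]
    {f g : DiagTensor 𝕜 A V →ₗ[SmashProduct 𝕜 H A] N}
    (h : ∀ v, f (unitMap 𝕜 H A V v) = g (unitMap 𝕜 H A V v)) : f = g := by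
  refine LinearMap.ext fun x => ?_
  induction x using DiagTensor.induction with
  | zero => rw [map_zero, map_zero]
  | add x y hx hy => rw [map_add, map_add, hx, hy]
  | mk a v => rw [← mk_smul_unitMap (H := H), map_smul, map_smul, h]

/-- Maps out of `A ⊗ V` over `A # H` are the same as maps out of `V` over `H`, and `V` is projective
over the semisimple ring `H`. So the map is lifted on `V` and then extended. -/
theorem induced_lifting [IsSemisimpleRing H] {N P : Type u} [AddCommGroup N]
    [Module (SmashProduct 𝕜 H A) N] [AddCommGroup P] [Module (SmashProduct 𝕜 H A) P]
    (f : N →ₗ[SmashProduct 𝕜 H A] P) (hf : Function.Surjective f)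
    (g : DiagTensor 𝕜 A V →ₗ[SmashProduct 𝕜 H A] P) :
    ∃ h : DiagTensor 𝕜 A V →ₗ[SmashProduct 𝕜 H A] N, f ∘ₗ h = g := by
  let := scalarModule 𝕜 H A N
  let := hopfModule 𝕜 H A N
  let := scalarModule 𝕜 H A P
  let := hopfModule 𝕜 H A P
  have := smashTower_hopfModule (𝕜 := 𝕜) (H := H) (A := A) N
  have := smashTower_hopfModule (𝕜 := 𝕜) (H := H) (A := A) P
  have : Module.Projective H V := Module.projective_of_isSemisimpleRing H V
  obtain ⟨k, hk⟩ := Module.projective_lifting_property (hopfLinear f)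
    (hopfLinear g ∘ₗ unitMap 𝕜 H A V) hf
  refine ⟨extend k, induced_hom_ext fun v => ?_⟩
  rw [LinearMap.comp_apply, extend_unitMap]
  exact LinearMap.congr_fun hk v

instance [IsSemisimpleRing H] :
    Module.Projective (SmashProduct 𝕜 H A) (DiagTensor 𝕜 A V) := by
  refine Module.Projective.of_lifting_property'' fun f hf => ?_
  exact induced_lifting f hf LinearMap.id

end SmashModules

/-! ### Graded modules: projections, graded lifts, uniqueness of covers, Nakayama. -/

section Grading

variable {𝕜 : Type u} [Field 𝕜] {H : Type u} [Ring H] [HopfAlgebra 𝕜 H]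
  {A : Type u} [Ring A] [Algebra 𝕜 A] {𝒜 : ℕ → Submodule 𝕜 A}

theorem mk_mem_smashDegree {n : ℕ} {a : A} (ha : a ∈ 𝒜 n) (h : H) :
    SmashProduct.mk a h ∈ smashDegree H 𝒜 n :=
  tmul_mem_range ha h

variable [Module H A] [HModuleAlgebra 𝕜 H A]

theorem smash_homogeneous_induction [GradedAlgebra 𝒜] {C : SmashProduct 𝕜 H A → Prop}
    (zero : C 0) (mk : ∀ n, ∀ a ∈ 𝒜 n, ∀ h, C (SmashProduct.mk a h))
    (add : ∀ x y, C x → C y → C (x + y)) (x : SmashProduct 𝕜 H A) : C x := by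
  refine SmashProduct.induction zero (fun a h => ?_) add x
  induction a using DirectSum.Decomposition.inductionOn 𝒜 with
  | zero =>
    have z : SmashProduct.mk (0 : A) h = (0 : SmashProduct 𝕜 H A) := TensorProduct.zero_tmul _ _
    rwa [z]
  | @homogeneous n m => exact mk n m m.2 h
  | add p q hp hq =>
    rw [SmashProduct.mk_add_left]
    exact add _ _ hp hq

section Augmentation

variable [GradedAlgebra 𝒜] [ConnectedGraded 𝒜] [GradedAction H 𝒜]

theorem smashToHopf_mk (a : A) (h : H) :
    smashToHopf H 𝒜 (SmashProduct.mk a h) = augmentation 𝒜 a • h := rfl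

theorem smashToHopf_mk_one (h : H) : smashToHopf H 𝒜 (SmashProduct.mk 1 h) = h := by
  rw [smashToHopf_mk, map_one, one_smul]

variable (H 𝒜) in
/-- The kernel of `A # H → H`. -/
def positiveIdeal : Ideal (SmashProduct 𝕜 H A) := RingHom.ker (smashToHopf H 𝒜)

theorem mem_positiveIdeal {x : SmashProduct 𝕜 H A} :
    x ∈ positiveIdeal H 𝒜 ↔ smashToHopf H 𝒜 x = 0 := Iff.rfl

theorem mk_mem_positiveIdeal {n : ℕ} (hn : n ≠ 0) {a : A} (ha : a ∈ 𝒜 n) (h : H) :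
    SmashProduct.mk a h ∈ positiveIdeal H 𝒜 :=
  smashToHopf_of_mem H 𝒜 hn _ (mk_mem_smashDegree ha h)

/-- The kernel of `A # H → H` is spanned by the elements `a # h` with `a` homogeneous of positive
degree. -/
theorem positiveIdeal_induction {C : SmashProduct 𝕜 H A → Prop}
    (zero : C 0) (mk : ∀ n, n ≠ 0 → ∀ a ∈ 𝒜 n, ∀ h, C (SmashProduct.mk a h))
    (add : ∀ x y, C x → C y → C (x + y)) {x : SmashProduct 𝕜 H A}
    (hx : x ∈ positiveIdeal H 𝒜) : C x := by
  -- Subtracting the image under the section `h ↦ 1 # h` gives a statement about all `x`, which can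
  -- be checked on homogeneous elements: in degree `0` the difference vanishes because `A₀ = 𝕜`, and
  -- in positive degree nothing is subtracted.
  have key : ∀ x : SmashProduct 𝕜 H A, C (x - SmashProduct.ofHopf 𝕜 H A (smashToHopf H 𝒜 x)) := by
    intro x
    refine smash_homogeneous_induction (𝒜 := 𝒜)
      (C := fun x => C (x - SmashProduct.ofHopf 𝕜 H A (smashToHopf H 𝒜 x)))
      ?_ (fun n a ha h => ?_) (fun p q hp hq => ?_) x
    · rwa [map_zero, map_zero, sub_zero]
    · by_cases hn : n = 0
      · subst hn
        obtain ⟨c, hc⟩ := (algebraMap_zero_bijective 𝒜).2 ⟨a, ha⟩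
        have hm : a = algebraMap 𝕜 A c := (congrArg Subtype.val hc).symm
        rw [smashToHopf_mk, hm, augmentation_algebraMap, Algebra.algebraMap_eq_smul_one,
          SmashProduct.mk_smul_left, ← SmashProduct.mk_smul_right]
        change C (SmashProduct.mk 1 (c • h) - SmashProduct.mk 1 (c • h))
        rwa [sub_self]
      · rw [mem_positiveIdeal.1 (mk_mem_positiveIdeal hn ha h), map_zero, sub_zero]
        exact mk n hn a ha h
    · rw [map_add, map_add, add_sub_add_comm]
      exact add _ _ hp hq
  have := key x
  rwa [mem_positiveIdeal.1 hx, map_zero, sub_zero] at this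

end Augmentation

namespace GradedModule

variable (M N : GradedModule H 𝒜)

instance : DirectSum.Decomposition M.deg := M.isInternal.chooseDecomposition

/-- The projection of a graded module onto its component of degree `d`. -/
def proj (d : ℤ) : M.carrier →+ M.carrier :=
  (M.deg d).subtype.comp ((DFinsupp.evalAddMonoidHom d).comp
    (DirectSum.decomposeAddEquiv M.deg).toAddMonoidHom)

variable {M N}

theorem proj_mem (d : ℤ) (x : M.carrier) : M.proj d x ∈ M.deg d := SetLike.coe_mem _

theorem proj_of_mem {d : ℤ} {x : M.carrier} (hx : x ∈ M.deg d) : M.proj d x = x :=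
  DirectSum.decompose_of_mem_same _ hx

theorem proj_of_mem_ne {d e : ℤ} {x : M.carrier} (hx : x ∈ M.deg d) (h : d ≠ e) :
    M.proj e x = 0 :=
  DirectSum.decompose_of_mem_ne _ hx h

theorem exists_sum_proj (x : M.carrier) : ∃ s : Finset ℤ, ∑ d ∈ s, M.proj d x = x := by
  classical
  exact ⟨_, DirectSum.sum_support_decompose M.deg x⟩

theorem mem_of_proj_mem {K : AddSubgroup M.carrier} {x : M.carrier} (h : ∀ d, M.proj d x ∈ K) :
    x ∈ K := by
  obtain ⟨s, hs⟩ := exists_sum_proj x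
  rw [← hs]
  exact sum_mem fun d _ => h d

theorem induction {C : M.carrier → Prop} (zero : C 0) (mk : ∀ d, ∀ x ∈ M.deg d, C x)
    (add : ∀ x y, C x → C y → C (x + y)) (x : M.carrier) : C x := by
  obtain ⟨s, hs⟩ := exists_sum_proj x
  rw [← hs]
  exact Finset.sum_induction _ C add zero fun d _ => mk d _ (proj_mem d x)

theorem proj_smul {n : ℕ} {a : SmashProduct 𝕜 H A} (ha : a ∈ smashDegree H 𝒜 n) (d : ℤ)
    (x : M.carrier) : M.proj (n + d) (a • x) = a • M.proj d x := by
  induction x using GradedModule.induction with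
  | zero => simp
  | add x y hx hy => rw [smul_add, map_add, map_add, smul_add, hx, hy]
  | mk e x hx =>
    have h := M.smul_mem n e a x ha hx
    by_cases hd : e = d
    · subst hd
      rw [proj_of_mem h, proj_of_mem hx]
    · rw [proj_of_mem_ne h (by omega), proj_of_mem_ne hx hd, smul_zero]

theorem proj_comm {f : M.carrier →ₗ[SmashProduct 𝕜 H A] N.carrier} (hf : IsGradedHom f) (d : ℤ)
    (x : M.carrier) : N.proj d (f x) = f (M.proj d x) := by
  induction x using GradedModule.induction with
  | zero => simp
  | add x y hx hy => simp only [map_add, hx, hy]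
  | mk e x hx =>
    by_cases hd : e = d
    · subst hd
      rw [proj_of_mem hx, proj_of_mem (hf _ _ hx)]
    · rw [proj_of_mem_ne hx hd, proj_of_mem_ne (hf _ _ hx) hd, map_zero]

/-- An element is the finite sum of its projections. Stability under the projections is the form in
which gradedness is verified and used below. -/
theorem isGradedSubmodule_iff {K : Submodule (SmashProduct 𝕜 H A) M.carrier} :
    M.IsGradedSubmodule K ↔ ∀ x ∈ K, ∀ d, M.proj d x ∈ K := by
  constructor
  · intro h x hx d
    have hx : x ∈ ⨆ d, K.toAddSubgroup ⊓ M.deg d := by rw [← h]; exact hx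
    refine AddSubgroup.iSup_induction (C := fun x => M.proj d x ∈ K) _ hx
      (fun e x hx => ?_) ?_ fun x y hx hy => ?_
    · by_cases hd : e = d
      · subst hd
        rw [proj_of_mem hx.2]
        exact hx.1
      · rw [proj_of_mem_ne hx.2 hd]
        exact K.zero_mem
    · rw [map_zero]
      exact K.zero_mem
    · rw [map_add]
      exact K.add_mem hx hy
  · intro h
    refine le_antisymm (fun x hx => ?_) (iSup_le fun d => inf_le_left)
    exact mem_of_proj_mem fun d => AddSubgroup.mem_iSup_of_mem d ⟨h x hx d, proj_mem d x⟩

theorem isGradedSubmodule_top : M.IsGradedSubmodule ⊤ :=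
  isGradedSubmodule_iff.2 fun _ _ _ => trivial

theorem isGradedSubmodule_range {f : M.carrier →ₗ[SmashProduct 𝕜 H A] N.carrier}
    (hf : IsGradedHom f) : N.IsGradedSubmodule (LinearMap.range f) := by
  rw [isGradedSubmodule_iff]
  rintro _ ⟨x, rfl⟩ d
  exact ⟨M.proj d x, (proj_comm hf d x).symm⟩

theorem isGradedSubmodule_ker {f : M.carrier →ₗ[SmashProduct 𝕜 H A] N.carrier}
    (hf : IsGradedHom f) : M.IsGradedSubmodule (LinearMap.ker f) := by
  rw [isGradedSubmodule_iff]
  intro x hx d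
  rw [LinearMap.mem_ker] at hx ⊢
  rw [← proj_comm hf, hx, map_zero]

theorem mem_deg_iff {d : ℤ} {x : M.carrier} : x ∈ M.deg d ↔ M.proj d x = x :=
  ⟨proj_of_mem, fun h => h ▸ proj_mem d x⟩

/-- A bijective graded homomorphism is an isomorphism of graded modules. -/
theorem mem_deg_iff_of_injective {f : M.carrier →ₗ[SmashProduct 𝕜 H A] N.carrier}
    (hf : IsGradedHom f) (hi : Function.Injective f) (d : ℤ) (x : M.carrier) :
    f x ∈ N.deg d ↔ x ∈ M.deg d := by
  refine ⟨fun h => ?_, hf d x⟩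
  rw [mem_deg_iff] at h ⊢
  exact hi ((proj_comm hf d x).symm.trans h)

theorem Isomorphic.symm (h : M.Isomorphic N) : N.Isomorphic M := by
  obtain ⟨e, he⟩ := h
  refine ⟨e.symm, fun d x => ?_⟩
  rw [← he, LinearEquiv.apply_symm_apply]

theorem Isomorphic.trans {K : GradedModule H 𝒜} (h : M.Isomorphic N) (h' : N.Isomorphic K) :
    M.Isomorphic K := by
  obtain ⟨e, he⟩ := h
  obtain ⟨e', he'⟩ := h'
  exact ⟨e.trans e', fun d x => (he' d (e x)).trans (he d x)⟩

/-- The first term of a resolution covers a submodule of its own zeroth term. Transport along an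
isomorphism from that term to `A ⊗ V` makes it comparable with an explicit cover. -/
theorem IsProjectiveCover.comp_equiv {P N : GradedModule H 𝒜}
    {f : P.carrier →ₗ[SmashProduct 𝕜 H A] M.carrier}
    {K : Submodule (SmashProduct 𝕜 H A) M.carrier} (hf : IsProjectiveCover f K)
    (e : M.carrier ≃ₗ[SmashProduct 𝕜 H A] N.carrier)
    (he : ∀ d x, e x ∈ N.deg d ↔ x ∈ M.deg d) :
    IsProjectiveCover (P := P) (M := N) (e.toLinearMap ∘ₗ f) (K.map e.toLinearMap) where
  projective := hf.projective
  graded d x hx := (he d (f x)).2 (hf.graded d x hx)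
  range_eq := by rw [LinearMap.range_comp, hf.range_eq]
  superfluous K hK h := hf.superfluous K hK (by rwa [LinearEquiv.ker_comp] at h)

section DegreeZero

/-- The underlying additive map of the degree zero part of a homomorphism. -/
def degreeZeroAux (f : M.carrier →ₗ[SmashProduct 𝕜 H A] N.carrier) : M.carrier →+ N.carrier :=
  (DirectSum.toAddMonoid fun d =>
    ((N.proj d).comp f.toAddMonoidHom).comp (M.deg d).subtype).comp
      (DirectSum.decomposeAddEquiv M.deg).toAddMonoidHom

theorem degreeZeroAux_of_mem (f : M.carrier →ₗ[SmashProduct 𝕜 H A] N.carrier) {d : ℤ}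
    {x : M.carrier} (hx : x ∈ M.deg d) : degreeZeroAux f x = N.proj d (f x) := by
  change (DirectSum.toAddMonoid fun d => ((N.proj d).comp f.toAddMonoidHom).comp
    (M.deg d).subtype) (DirectSum.decompose M.deg x) = _
  rw [DirectSum.decompose_of_mem _ hx, DirectSum.toAddMonoid_of]
  rfl

variable [GradedAlgebra 𝒜]

/-- The degree zero part of a homomorphism between graded modules. -/
def degreeZero (f : M.carrier →ₗ[SmashProduct 𝕜 H A] N.carrier) :
    M.carrier →ₗ[SmashProduct 𝕜 H A] N.carrier where
  toFun := degreeZeroAux f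
  map_add' := map_add _
  map_smul' a x := by
    rw [RingHom.id_apply]
    refine smash_homogeneous_induction (𝒜 := 𝒜)
      (C := fun a => degreeZeroAux f (a • x) = a • degreeZeroAux f x)
      ?_ (fun n a ha h => ?_) (fun p q hp hq => ?_) a
    · rw [zero_smul, zero_smul, map_zero]
    · have ha := mk_mem_smashDegree (𝒜 := 𝒜) ha h
      induction x using GradedModule.induction with
      | zero => rw [smul_zero, map_zero, smul_zero]
      | add x y hx hy => rw [smul_add, map_add, map_add, smul_add, hx, hy]
      | mk d x hx =>
        rw [degreeZeroAux_of_mem f hx, degreeZeroAux_of_mem f (M.smul_mem n d _ x ha hx), map_smul,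
          proj_smul ha]
    · rw [add_smul, add_smul, map_add, hp, hq]

theorem degreeZero_of_mem (f : M.carrier →ₗ[SmashProduct 𝕜 H A] N.carrier) {d : ℤ}
    {x : M.carrier} (hx : x ∈ M.deg d) : degreeZero f x = N.proj d (f x) :=
  degreeZeroAux_of_mem f hx

theorem isGradedHom_degreeZero (f : M.carrier →ₗ[SmashProduct 𝕜 H A] N.carrier) :
    IsGradedHom (degreeZero f) := fun d x hx => by
  rw [degreeZero_of_mem f hx]
  exact proj_mem d _

/-- Projective graded modules have the lifting property with respect to graded homomorphisms. -/
theorem exists_graded_lift {P Q : GradedModule H 𝒜}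
    (hP : Module.Projective (SmashProduct 𝕜 H A) P.carrier)
    {f : P.carrier →ₗ[SmashProduct 𝕜 H A] M.carrier} (hf : IsGradedHom f)
    {g : Q.carrier →ₗ[SmashProduct 𝕜 H A] M.carrier} (hg : IsGradedHom g)
    (h : LinearMap.range f ≤ LinearMap.range g) :
    ∃ k : P.carrier →ₗ[SmashProduct 𝕜 H A] Q.carrier, IsGradedHom k ∧ g ∘ₗ k = f := by
  -- Ungraded projectivity gives a lift that may mix degrees. Its degree zero part is still a lift,
  -- because `f` and `g` are graded.
  obtain ⟨k, hk⟩ := Module.projective_lifting_property g.rangeRestrict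
    (f.codRestrict (LinearMap.range g) fun x => h ⟨x, rfl⟩) g.surjective_rangeRestrict
  have hk : ∀ x, g (k x) = f x := fun x => congrArg Subtype.val (LinearMap.congr_fun hk x)
  refine ⟨degreeZero k, isGradedHom_degreeZero k, LinearMap.ext fun x => ?_⟩
  rw [LinearMap.comp_apply]
  induction x using GradedModule.induction with
  | zero => simp
  | add x y hx hy => simp only [map_add, hx, hy]
  | mk d x hx => rw [degreeZero_of_mem k hx, ← proj_comm hg, hk, proj_of_mem (hf d x hx)]

/-- Graded projective covers are unique up to isomorphism. -/
theorem IsProjectiveCover.exists_equiv {P Q : GradedModule H 𝒜}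
    {f : P.carrier →ₗ[SmashProduct 𝕜 H A] M.carrier}
    {g : Q.carrier →ₗ[SmashProduct 𝕜 H A] M.carrier}
    {K : Submodule (SmashProduct 𝕜 H A) M.carrier} (hf : IsProjectiveCover f K)
    (hg : IsProjectiveCover g K) :
    ∃ e : P.carrier ≃ₗ[SmashProduct 𝕜 H A] Q.carrier,
      (∀ d x, e x ∈ Q.deg d ↔ x ∈ P.deg d) ∧ ∀ x, g (e x) = f x := by
  obtain ⟨k, hk, hgk⟩ := exists_graded_lift hf.projective hf.graded hg.graded
    (by rw [hf.range_eq, hg.range_eq])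
  have hgk : ∀ x, g (k x) = f x := fun x => LinearMap.congr_fun hgk x
  -- Any graded comparison map between two covers is onto: its range together with `ker g` is
  -- everything, and `ker g` is superfluous. The statement is general so that it can also be applied
  -- with the two covers exchanged.
  have cover : ∀ {P Q : GradedModule H 𝒜}
      {f : P.carrier →ₗ[SmashProduct 𝕜 H A] M.carrier}
      {g : Q.carrier →ₗ[SmashProduct 𝕜 H A] M.carrier} (_ : IsProjectiveCover f K)
      (_ : IsProjectiveCover g K) (k : P.carrier →ₗ[SmashProduct 𝕜 H A] Q.carrier),
      IsGradedHom k → (∀ x, g (k x) = f x) → Function.Surjective k := by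
    intro P Q f g hf hg k hk hgk
    refine LinearMap.range_eq_top.1 (hg.superfluous _ (isGradedSubmodule_range hk) ?_)
    rw [eq_top_iff]
    rintro y -
    have hy : g y ∈ LinearMap.range f := by
      rw [hf.range_eq, ← hg.range_eq]
      exact ⟨y, rfl⟩
    obtain ⟨x, hx⟩ := hy
    refine Submodule.mem_sup.2 ⟨y - k x, ?_, k x, ⟨x, rfl⟩, sub_add_cancel _ _⟩
    rw [LinearMap.mem_ker, map_sub, hgk, hx, sub_self]
  have surj := cover hf hg k hk hgk
  -- Projectivity splits `k`. The section `σ` is itself a comparison map, hence onto, and this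
  -- forces `k` to be injective.
  obtain ⟨σ, hσ, hkσ⟩ := exists_graded_lift (f := LinearMap.id) hg.projective (fun _ _ h => h) hk
    (by rw [LinearMap.range_eq_top.2 surj]; exact le_top)
  have hkσ : ∀ y, k (σ y) = y := fun y => LinearMap.congr_fun hkσ y
  have surj' := cover hg hf σ hσ fun y => by rw [← hgk, hkσ]
  have inj : Function.Injective k := by
    intro x y hxy
    obtain ⟨x, rfl⟩ := surj' x
    obtain ⟨y, rfl⟩ := surj' y
    rw [hkσ, hkσ] at hxy
    rw [hxy]
  exact ⟨LinearEquiv.ofBijective k ⟨inj, surj⟩, mem_deg_iff_of_injective hk inj, hgk⟩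

end DegreeZero

section Nakayama

variable [GradedAlgebra 𝒜] [ConnectedGraded 𝒜] [GradedAction H 𝒜]

variable (M) in
/-- The graded module `M` is bounded below. -/
def BoundedBelow : Prop := ∃ c : ℤ, ∀ d < c, M.deg d = ⊥

theorem isGradedSubmodule_positiveIdeal_smul {K : Submodule (SmashProduct 𝕜 H A) M.carrier}
    (hK : M.IsGradedSubmodule K) : M.IsGradedSubmodule (positiveIdeal H 𝒜 • K) := by
  rw [isGradedSubmodule_iff] at hK ⊢
  intro x hx d
  refine Submodule.smul_induction_on (p := fun x => M.proj d x ∈ positiveIdeal H 𝒜 • K) hx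
    (fun a ha x hx => ?_) fun x y hx hy => by rw [map_add]; exact add_mem hx hy
  refine positiveIdeal_induction (C := fun a => M.proj d (a • x) ∈ positiveIdeal H 𝒜 • K)
    ?_ (fun n hn a ha h => ?_) (fun p q hp hq => ?_) ha
  · rw [zero_smul, map_zero]; exact zero_mem _
  · have e := proj_smul (M := M) (mk_mem_smashDegree ha h) (d - n) x
    rw [show (n : ℤ) + (d - n) = d by ring] at e
    rw [e]
    exact Submodule.smul_mem_smul (mk_mem_positiveIdeal hn ha h) (hK x hx _)
  · rw [add_smul, map_add]; exact add_mem hp hq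

/-- The graded Nakayama lemma. -/
theorem nakayama (hM : M.BoundedBelow) {K L : Submodule (SmashProduct 𝕜 H A) M.carrier}
    (hL : M.IsGradedSubmodule L)
    (h : K ≤ L ⊔ positiveIdeal H 𝒜 • K) : K ≤ L := by
  obtain ⟨c, hc⟩ := hM
  rw [isGradedSubmodule_iff] at hL
  -- Induction on the height above the lower bound `c`: if `a ∈ Aₙ` with `n > 0`, the degree `d`
  -- part of `(a # h) x` involves only the part of `x` in the lower degree `d - n`.
  have key : ∀ k : ℕ, ∀ d : ℤ, d < c + k → ∀ x ∈ K, M.proj d x ∈ L := by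
    intro k
    induction k with
    | zero =>
      intro d hd x hx
      have hp := M.proj_mem d x
      rw [hc d (by simpa using hd), AddSubgroup.mem_bot] at hp
      rw [hp]
      exact zero_mem _
    | succ k ih =>
      intro d hd x hx
      obtain ⟨y, hy, z, hz, rfl⟩ := Submodule.mem_sup.1 (h hx)
      rw [map_add]
      refine add_mem (hL y hy d) ?_
      refine Submodule.smul_induction_on (p := fun x => M.proj d x ∈ L) hz
        (fun a ha x hx => ?_) fun x y hx hy => by rw [map_add]; exact add_mem hx hy
      refine positiveIdeal_induction (C := fun a => M.proj d (a • x) ∈ L)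
        ?_ (fun n hn a ha h => ?_) (fun p q hp hq => ?_) ha
      · rw [zero_smul, map_zero]; exact zero_mem _
      · have e := proj_smul (M := M) (mk_mem_smashDegree ha h) (d - n) x
        rw [show (n : ℤ) + (d - n) = d by ring] at e
        rw [e]
        exact L.smul_mem _ (ih _ (by push_cast at hd; omega) x hx)
      · rw [add_smul, map_add]; exact add_mem hp hq
  intro x hx
  refine mem_of_proj_mem (K := L.toAddSubgroup) fun d => ?_
  -- Any `k` with `d < c + k` would do; this one also covers `d < c`, where it is `0`.
  exact key (d - c + 1).toNat d (by omega) x hx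

end Nakayama

end GradedModule

end Grading

theorem augmentation_of_mem {𝕜 : Type u} [Field 𝕜] {A : Type u} [Ring A] [Algebra 𝕜 A]
    {𝒜 : ℕ → Submodule 𝕜 A} [GradedAlgebra 𝒜] [ConnectedGraded 𝒜] {n : ℕ} (hn : n ≠ 0) {a : A}
    (ha : a ∈ 𝒜 n) : augmentation 𝒜 a = 0 := by
  refine augmentation_eq_of 𝒜 ?_
  rw [map_zero]
  exact (DirectSum.decompose_of_mem_ne 𝒜 ha hn).symm

/-! ### The projective cover `A ⊗ X → X`. -/

section Covers

variable {𝕜 : Type u} [Field 𝕜] {H : Type u} [Ring H] [HopfAlgebra 𝕜 H]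
  {A : Type u} [Ring A] [Algebra 𝕜 A] {𝒜 : ℕ → Submodule 𝕜 A}
  [Module H A] [HModuleAlgebra 𝕜 H A] [GradedAlgebra 𝒜] [GradedAction H 𝒜]

namespace GradedModule

variable {M P : GradedModule H 𝒜}

section Criterion

variable [ConnectedGraded 𝒜]

/-- A criterion for `f : P → M` to be a projective cover of `K`: the additive group `X` maps onto
`P / J P`, where `J` is the kernel of `A # H → H`, and embeds into `K / J K`. -/
theorem IsProjectiveCover.of_generators {X : Type u} [AddCommGroup X]
    (hP : Module.Projective (SmashProduct 𝕜 H A) P.carrier) (hb : P.BoundedBelow)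
    (U : X →+ P.carrier) (E : P.carrier →+ X)
    (hUE : ∀ z, z - U (E z) ∈ positiveIdeal H 𝒜 • (⊤ : Submodule (SmashProduct 𝕜 H A) P.carrier))
    {f : P.carrier →ₗ[SmashProduct 𝕜 H A] M.carrier} (hf : IsGradedHom f)
    {K : Submodule (SmashProduct 𝕜 H A) M.carrier} (hK : LinearMap.range f = K)
    (hker : ∀ x, f (U x) ∈ positiveIdeal H 𝒜 • K → x = 0) : IsProjectiveCover f K where
  projective := hP
  graded := hf
  range_eq := hK
  superfluous N hN h := by
    rw [eq_top_iff]
    -- By Nakayama it is enough that `ker f` lies in `J P`. If `f z = 0`, then `z ≡ U (E z)` modulo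
    -- `J P` gives `f (U (E z)) ∈ J K`; hence `E z = 0` and `z ∈ J P`.
    refine nakayama hb hN fun y _ => ?_
    have hy : y ∈ LinearMap.ker f ⊔ N := by rw [h]; trivial
    obtain ⟨z, hz, n, hn, rfl⟩ := Submodule.mem_sup.1 hy
    refine add_mem (Submodule.mem_sup_right ?_) (Submodule.mem_sup_left hn)
    have hf : ∀ y ∈ positiveIdeal H 𝒜 • (⊤ : Submodule (SmashProduct 𝕜 H A) P.carrier),
        f y ∈ positiveIdeal H 𝒜 • K := fun y hy =>
      Submodule.smul_induction_on (p := fun y => f y ∈ positiveIdeal H 𝒜 • K) hy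
        (fun a ha y _ => by
          rw [map_smul]
          exact Submodule.smul_mem_smul ha (hK ▸ ⟨y, rfl⟩))
        fun x y hx hy => by rw [map_add]; exact add_mem hx hy
    have e : E z = 0 := by
      refine hker _ ?_
      have := hf _ (hUE z)
      rw [map_sub, LinearMap.mem_ker.1 hz, zero_sub] at this
      exact neg_mem_iff.1 this
    have := hUE z
    rwa [e, map_zero, sub_zero] at this

end Criterion

section Inflated

variable {X : Type u} [AddCommGroup X] [Module H X] [ConnectedGraded 𝒜]

variable (H 𝒜 X) in
/-- The identification of `X` with the underlying group of its inflation. -/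
def inflate : X ≃+ (inflatedModule H 𝒜 X).carrier := AddEquiv.refl X

theorem smul_inflate (a : SmashProduct 𝕜 H A) (x : X) :
    a • inflate H 𝒜 X x = inflate H 𝒜 X (smashToHopf H 𝒜 a • x) := rfl

theorem inflate_mem (x : X) : inflate H 𝒜 X x ∈ (inflatedModule H 𝒜 X).deg 0 := by
  change x ∈ if (0 : ℤ) = 0 then (⊤ : AddSubgroup X) else ⊥
  rw [if_pos rfl]
  trivial

theorem positiveIdeal_smul_inflated (x : (inflatedModule H 𝒜 X).carrier)
    (hx : x ∈ positiveIdeal H 𝒜 •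
      (⊤ : Submodule (SmashProduct 𝕜 H A) (inflatedModule H 𝒜 X).carrier)) : x = 0 := by
  refine Submodule.smul_induction_on (p := fun y => y = 0) hx (fun a ha y _ => ?_)
    fun y z hy hz => by rw [hy, hz, add_zero]
  rw [← (inflate H 𝒜 X).apply_symm_apply y, smul_inflate, mem_positiveIdeal.1 ha, zero_smul,
    map_zero]

end Inflated

section Induced

variable {X : Type u} [AddCommGroup X] [Module 𝕜 X] [Module H X] [IsScalarTower 𝕜 H X]

variable (H 𝒜) in
/-- The pure tensor `a ⊗ x` in the graded module `A ⊗ X`. -/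
def tmul (a : A) (x : X) : (inducedModule H 𝒜 X).carrier := DiagTensor.mk 𝕜 a x

variable (H 𝒜 X) in
/-- The map `X → A ⊗ X`, `x ↦ 1 ⊗ x`. -/
def unitHom : X →+ (inducedModule H 𝒜 X).carrier := (unitMap 𝕜 H A X).toAddMonoidHom

theorem unitHom_apply (x : X) : unitHom H 𝒜 X x = tmul H 𝒜 1 x := rfl

theorem mk_smul_tmul (a b : A) (x : X) :
    (SmashProduct.mk a 1 : SmashProduct 𝕜 H A) • tmul H 𝒜 b x = tmul H 𝒜 (a * b) x :=
  SmashProduct.mk_one_smul_mk a b x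

theorem mk_smul_unitHom (a : A) (x : X) :
    (SmashProduct.mk a 1 : SmashProduct 𝕜 H A) • unitHom H 𝒜 X x = tmul H 𝒜 a x :=
  mk_smul_unitMap a x

theorem tmul_sub_tmul (a b : A) (x : X) :
    tmul H 𝒜 a x - tmul H 𝒜 b x = tmul H 𝒜 (a - b) x :=
  (TensorProduct.sub_tmul a b x).symm

theorem tmul_add_left (a b : A) (x : X) :
    tmul H 𝒜 (a + b) x = tmul H 𝒜 a x + tmul H 𝒜 b x :=
  TensorProduct.add_tmul a b x

theorem tmul_zero_left (x : X) : tmul H 𝒜 0 x = 0 := TensorProduct.zero_tmul _ x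

theorem tmul_algebraMap (c : 𝕜) (x : X) :
    tmul H 𝒜 (algebraMap 𝕜 A c) x = unitHom H 𝒜 X (c • x) := by
  rw [Algebra.algebraMap_eq_smul_one]
  exact TensorProduct.smul_tmul c 1 x

theorem induced_induction {C : (inducedModule H 𝒜 X).carrier → Prop} (zero : C 0)
    (mk : ∀ a x, C (tmul H 𝒜 a x)) (add : ∀ y z, C y → C z → C (y + z))
    (z : (inducedModule H 𝒜 X).carrier) : C z :=
  TensorProduct.induction_on z zero mk add

theorem tmul_mem_deg {n : ℕ} {a : A} (ha : a ∈ 𝒜 n) (x : X) :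
    tmul H 𝒜 a x ∈ (inducedModule H 𝒜 X).deg n := by
  change a ⊗ₜ x ∈ inducedDegree 𝒜 X n
  rw [inducedDegree_natCast]
  exact tmul_mem_range ha x

theorem unitHom_mem (x : X) : unitHom H 𝒜 X x ∈ (inducedModule H 𝒜 X).deg 0 :=
  tmul_mem_deg (n := 0) SetLike.GradedOne.one_mem x

theorem deg_neg {d : ℤ} (hd : d < 0) : (inducedModule H 𝒜 X).deg d = ⊥ := by
  change (inducedDegree 𝒜 X d).toAddSubgroup = ⊥
  rw [inducedDegree_of_neg _ _ hd]
  rfl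

theorem boundedBelow_induced : (inducedModule H 𝒜 X).BoundedBelow :=
  ⟨0, fun _ hd => deg_neg hd⟩

theorem deg_induction {d : ℤ} {C : (inducedModule H 𝒜 X).carrier → Prop} (zero : C 0)
    (mk : ∀ n : ℕ, n = d → ∀ a ∈ 𝒜 n, ∀ x, C (tmul H 𝒜 a x))
    (add : ∀ y z, C y → C z → C (y + z)) {y : (inducedModule H 𝒜 X).carrier}
    (hy : y ∈ (inducedModule H 𝒜 X).deg d) : C y := by
  rcases lt_or_ge d 0 with hd | hd
  · rw [deg_neg hd, AddSubgroup.mem_bot] at hy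
    rwa [hy]
  · obtain ⟨n, rfl⟩ := Int.eq_ofNat_of_zero_le hd
    have hy : y ∈ inducedDegree 𝒜 X n := hy
    rw [inducedDegree_natCast] at hy
    exact range_rTensor_induction (C := C) zero (fun a ha v => mk n rfl a ha v) add hy

section Lift

variable [Module 𝕜 M.carrier] [Module H M.carrier] [SmashTower 𝕜 H A M.carrier]

/-- The homomorphism from `A ⊗ X` that extends `g : X → M`. -/
def inducedLift (g : X →ₗ[H] M.carrier) :
    (inducedModule H 𝒜 X).carrier →ₗ[SmashProduct 𝕜 H A] M.carrier :=
  extend g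

theorem inducedLift_tmul (g : X →ₗ[H] M.carrier) (a : A) (x : X) :
    inducedLift g (tmul H 𝒜 a x) = (SmashProduct.mk a 1 : SmashProduct 𝕜 H A) • g x := rfl

theorem inducedLift_unitHom (g : X →ₗ[H] M.carrier) (x : X) :
    inducedLift g (unitHom H 𝒜 X x) = g x :=
  extend_unitMap g x

theorem inducedLift_mem_deg {g : X →ₗ[H] M.carrier} {c : ℤ} (hg : ∀ x, g x ∈ M.deg c)
    {d : ℤ} {z : (inducedModule H 𝒜 X).carrier} (hz : z ∈ (inducedModule H 𝒜 X).deg d) :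
    inducedLift g z ∈ M.deg (d + c) := by
  refine deg_induction (C := fun z => inducedLift g z ∈ M.deg (d + c))
    ?_ (fun n hn a ha x => ?_) (fun y z hy hz => ?_) hz
  · rw [map_zero]
    exact zero_mem _
  · subst hn
    rw [inducedLift_tmul]
    exact M.smul_mem n c _ _ (mk_mem_smashDegree ha (1 : H)) (hg x)
  · rw [map_add]
    exact add_mem hy hz

theorem inducedLift_mem {g : X →ₗ[H] M.carrier}
    {K : Submodule (SmashProduct 𝕜 H A) M.carrier} (hg : ∀ x, g x ∈ K)
    (z : (inducedModule H 𝒜 X).carrier) : inducedLift g z ∈ K := by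
  refine induced_induction (C := fun z => inducedLift g z ∈ K)
    ?_ (fun a x => ?_) (fun y z hy hz => ?_) z
  · rw [map_zero]
    exact zero_mem _
  · exact K.smul_mem _ (hg x)
  · rw [map_add]
    exact add_mem hy hz

end Lift

variable [ConnectedGraded 𝒜]

variable (H 𝒜 X) in
/-- The action of `A # H` on an `H`-module, through the projection `A # H → H`. -/
abbrev inflatedAction : Module (SmashProduct 𝕜 H A) X := Module.compHom X (smashToHopf H 𝒜)

theorem smashTower_inflatedAction :
    letI := inflatedAction H 𝒜 X
    SmashTower 𝕜 H A X :=
  letI := inflatedAction H 𝒜 X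
  { mk_one_smul := fun h x => congrArg (· • x) (smashToHopf_mk_one (𝒜 := 𝒜) h) }

variable (H 𝒜 X) in
/-- The map `A ⊗ X → X`, `a ⊗ x ↦ ε(a) x`, where `X` carries the inflated action. -/
def counitMapAux :
    letI := inflatedAction H 𝒜 X
    DiagTensor 𝕜 A X →ₗ[SmashProduct 𝕜 H A] X :=
  letI := inflatedAction H 𝒜 X
  haveI : SmashTower 𝕜 H A X := smashTower_inflatedAction (𝒜 := 𝒜)
  extend (LinearMap.id : X →ₗ[H] X)

variable (H 𝒜 X) in
/-- The map `A ⊗ X → X`, `a ⊗ x ↦ ε(a) x`. -/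
def counitMap : (inducedModule H 𝒜 X).carrier →ₗ[SmashProduct 𝕜 H A]
    (inflatedModule H 𝒜 X).carrier :=
  counitMapAux H 𝒜 X

theorem counitMap_tmul (a : A) (x : X) :
    counitMap H 𝒜 X (tmul H 𝒜 a x) = inflate H 𝒜 X (augmentation 𝒜 a • x) := by
  have e : smashToHopf H 𝒜 (SmashProduct.mk a 1) • x = augmentation 𝒜 a • x := by
    rw [smashToHopf_mk, smul_assoc, one_smul]
  exact congrArg (inflate H 𝒜 X) e

theorem counitMap_unitHom (x : X) :
    counitMap H 𝒜 X (unitHom H 𝒜 X x) = inflate H 𝒜 X x := by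
  rw [unitHom_apply, counitMap_tmul, map_one, one_smul]

variable (H 𝒜 X) in
/-- `counitMap` as a map into the vector space `X`. -/
def counitHom : (inducedModule H 𝒜 X).carrier →+ X :=
  (inflate H 𝒜 X).symm.toAddMonoidHom.comp (counitMap H 𝒜 X).toAddMonoidHom

theorem counitHom_apply (z : (inducedModule H 𝒜 X).carrier) :
    counitHom H 𝒜 X z = (inflate H 𝒜 X).symm (counitMap H 𝒜 X z) := rfl

theorem counitHom_tmul (a : A) (x : X) :
    counitHom H 𝒜 X (tmul H 𝒜 a x) = augmentation 𝒜 a • x := by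
  rw [counitHom_apply, counitMap_tmul, AddEquiv.symm_apply_apply]

theorem counitHom_unitHom (x : X) : counitHom H 𝒜 X (unitHom H 𝒜 X x) = x := by
  rw [counitHom_apply, counitMap_unitHom, AddEquiv.symm_apply_apply]

theorem tmul_sub_unitHom (a : A) (x : X) :
    tmul H 𝒜 a x - unitHom H 𝒜 X (counitHom H 𝒜 X (tmul H 𝒜 a x)) =
      tmul H 𝒜 (a - algebraMap 𝕜 A (augmentation 𝒜 a)) x := by
  rw [counitHom_tmul, ← tmul_algebraMap, tmul_sub_tmul]

theorem mk_mem_positiveIdeal_of_augmentation {a : A} (ha : augmentation 𝒜 a = 0) (h : H) :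
    SmashProduct.mk a h ∈ positiveIdeal H 𝒜 := by
  rw [mem_positiveIdeal, smashToHopf_mk, ha, zero_smul]

/-- On pure tensors, `a ⊗ x - 1 ⊗ ε(a) x = ((a - ε(a)) # 1)(1 ⊗ x)`, and `a - ε(a)` has augmentation
zero. So `X` generates `A ⊗ X` modulo `J`, as the criterion `of_generators` requires. -/
theorem sub_unitHom_mem (z : (inducedModule H 𝒜 X).carrier) :
    z - unitHom H 𝒜 X (counitHom H 𝒜 X z) ∈
      positiveIdeal H 𝒜 • (⊤ : Submodule (SmashProduct 𝕜 H A) (inducedModule H 𝒜 X).carrier) := by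
  refine induced_induction (C := fun z => z - unitHom H 𝒜 X (counitHom H 𝒜 X z) ∈
    positiveIdeal H 𝒜 • (⊤ : Submodule (SmashProduct 𝕜 H A) (inducedModule H 𝒜 X).carrier))
    ?_ (fun a x => ?_) (fun y z hy hz => ?_) z
  · rw [map_zero, map_zero, sub_zero]
    exact zero_mem _
  · rw [tmul_sub_unitHom, ← mk_smul_unitHom]
    refine Submodule.smul_mem_smul (mk_mem_positiveIdeal_of_augmentation ?_ _) trivial
    rw [map_sub, augmentation_algebraMap, sub_self]
  · rw [map_add, map_add, add_sub_add_comm]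
    exact add_mem hy hz

/-- Connectedness enters here: `A₀ = 𝕜` makes `1 ⊗ X` the whole degree zero component. It follows
that the kernel of `A ⊗ X → X` has no degree zero part. -/
theorem unitHom_counitHom_of_mem {z : (inducedModule H 𝒜 X).carrier}
    (hz : z ∈ (inducedModule H 𝒜 X).deg 0) : unitHom H 𝒜 X (counitHom H 𝒜 X z) = z := by
  refine deg_induction (C := fun z => unitHom H 𝒜 X (counitHom H 𝒜 X z) = z)
    ?_ (fun n hn a ha x => ?_) (fun y z hy hz => ?_) hz
  · rw [map_zero, map_zero]
  · obtain rfl : n = 0 := by omega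
    obtain ⟨c, hc⟩ := (algebraMap_zero_bijective 𝒜).2 ⟨a, ha⟩
    have hm : a = algebraMap 𝕜 A c := (congrArg Subtype.val hc).symm
    rw [hm, tmul_algebraMap, counitHom_unitHom]
  · rw [map_add, map_add, hy, hz]

theorem isGradedHom_counitMap : IsGradedHom (counitMap H 𝒜 X) := by
  intro d z hz
  refine deg_induction (C := fun z => counitMap H 𝒜 X z ∈ (inflatedModule H 𝒜 X).deg d)
    ?_ (fun n hn a ha x => ?_) (fun y z hy hz => ?_) hz
  · rw [map_zero]
    exact zero_mem _
  · rw [counitMap_tmul]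
    subst hn
    by_cases h : n = 0
    · subst h
      exact inflate_mem _
    · rw [augmentation_of_mem h ha, zero_smul, map_zero]
      exact zero_mem _
  · rw [map_add]
    exact add_mem hy hz

theorem counitMap_surjective : Function.Surjective (counitMap H 𝒜 X) := fun x =>
  ⟨unitHom H 𝒜 X ((inflate H 𝒜 X).symm x), by
    rw [counitMap_unitHom, AddEquiv.apply_symm_apply]⟩

/-- `A ⊗ X → X` is a projective cover. -/
theorem isProjectiveCover_counitMap [IsSemisimpleRing H] :
    IsProjectiveCover (counitMap H 𝒜 X) ⊤ := by
  refine IsProjectiveCover.of_generators (P := inducedModule H 𝒜 X)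
    (inferInstanceAs (Module.Projective (SmashProduct 𝕜 H A) (DiagTensor 𝕜 A X)))
    boundedBelow_induced (unitHom H 𝒜 X) (counitHom H 𝒜 X)
    sub_unitHom_mem isGradedHom_counitMap (LinearMap.range_eq_top.2 counitMap_surjective)
    fun x hx => ?_
  rw [counitMap_unitHom] at hx
  exact (inflate H 𝒜 X).map_eq_zero_iff.1 (positiveIdeal_smul_inflated _ hx)

end Induced

end GradedModule

end Covers

/-! ### Direct sums of shifted induced modules, and existence of minimal resolutions. -/

section FreeModules

variable {𝕜 : Type u} [Field 𝕜] {H : Type u} [Ring H] [HopfAlgebra 𝕜 H]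
  {A : Type u} [Ring A] [Algebra 𝕜 A] {𝒜 : ℕ → Submodule 𝕜 A}
  [Module H A] [HModuleAlgebra 𝕜 H A] [GradedAlgebra 𝒜] [GradedAction H 𝒜]

namespace GradedModule

section Free

variable {κ : Type} [DecidableEq κ] (X : κ → Type u) [∀ k, AddCommGroup (X k)]
  [∀ k, Module 𝕜 (X k)] [∀ k, Module H (X k)] [∀ k, IsScalarTower 𝕜 H (X k)] (δ : κ → ℤ)

variable (H 𝒜) in
/-- The direct sum of the modules `(A ⊗ X k)[-δ k]`. -/
def freeModule : GradedModule H 𝒜 where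
  -- Finitely supported families allow infinitely many summands, one for each degree in the
  -- construction of covers below.
  carrier := Π₀ k, (inducedModule H 𝒜 (X k)).carrier
  deg d :=
    -- With this shift the generators `1 ⊗ X k` sit in degree `δ k`.
    { carrier := {f | ∀ k, f k ∈ (inducedModule H 𝒜 (X k)).deg (-δ k + d)}
      zero_mem' := fun k => zero_mem _
      add_mem' := fun hf hg k => add_mem (hf k) (hg k)
      neg_mem' := fun hf k => neg_mem (hf k) }
  isInternal := by
    refine isInternal_of_proj _
      (fun d => DFinsupp.mapRange.addMonoidHom
        fun k => (inducedModule H 𝒜 (X k)).proj (-δ k + d))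
      (fun d f hf => ?_) (fun d e hde f hf => ?_) fun f => ?_
    · ext k
      exact proj_of_mem (hf k)
    · ext k
      exact proj_of_mem_ne (hf k) (by omega)
    · induction f using DFinsupp.induction with
      | h0 => exact zero_mem _
      | ha k b f _ _ hf =>
        refine add_mem ?_ hf
        clear * -
        induction b using GradedModule.induction with
        | zero => rw [DFinsupp.single_zero]; exact zero_mem _
        | add x y hx hy => rw [DFinsupp.single_add]; exact add_mem hx hy
        | mk e x hx =>
          refine AddSubgroup.mem_iSup_of_mem (δ k + e) fun l => ?_
          by_cases h : l = k
          · subst h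
            rw [DFinsupp.single_eq_same, neg_add_cancel_left]
            exact hx
          · rw [DFinsupp.single_eq_of_ne (by tauto)]
            exact zero_mem _
  smul_mem n d x m hx hm k := by
    have := (inducedModule H 𝒜 (X k)).smul_mem n _ x (m k) hx (hm k)
    rw [show (n : ℤ) + (-δ k + d) = -δ k + (n + d) by ring] at this
    rwa [DFinsupp.smul_apply]

variable (H 𝒜) in
/-- The inclusion of a summand. -/
def single (k : κ) :
    (inducedModule H 𝒜 (X k)).carrier →ₗ[SmashProduct 𝕜 H A] (freeModule H 𝒜 X δ).carrier :=
  DFinsupp.lsingle (M := fun k => (inducedModule H 𝒜 (X k)).carrier) k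

variable (H 𝒜) in
/-- The projection to a summand. -/
def coeff (k : κ) :
    (freeModule H 𝒜 X δ).carrier →ₗ[SmashProduct 𝕜 H A] (inducedModule H 𝒜 (X k)).carrier :=
  DFinsupp.lapply (M := fun k => (inducedModule H 𝒜 (X k)).carrier) k

variable {X δ}

theorem free_induction {C : (freeModule H 𝒜 X δ).carrier → Prop} (zero : C 0)
    (mk : ∀ k z, C (single H 𝒜 X δ k z)) (add : ∀ y z, C y → C z → C (y + z))
    (z : (freeModule H 𝒜 X δ).carrier) : C z :=
  DFinsupp.induction (p := fun z : Π₀ k, (inducedModule H 𝒜 (X k)).carrier => C z) z zero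
    fun k b _ _ _ hf => add _ _ (mk k b) hf

theorem mem_deg_free {d : ℤ} {f : (freeModule H 𝒜 X δ).carrier} :
    f ∈ (freeModule H 𝒜 X δ).deg d ↔
      ∀ k, coeff H 𝒜 X δ k f ∈ (inducedModule H 𝒜 (X k)).deg (-δ k + d) := Iff.rfl

theorem boundedBelow_free {c : ℤ} (hδ : ∀ k, c ≤ δ k) : (freeModule H 𝒜 X δ).BoundedBelow := by
  refine ⟨c, fun d hd => (AddSubgroup.eq_bot_iff_forall _).2 fun f hf => ?_⟩
  refine DFinsupp.ext fun k => ?_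
  have h := mem_deg_free.1 hf k
  rw [deg_neg (by have := hδ k; omega), AddSubgroup.mem_bot] at h
  exact h

theorem projective_free [IsSemisimpleRing H] :
    Module.Projective (SmashProduct 𝕜 H A) (freeModule H 𝒜 X δ).carrier :=
  inferInstanceAs (Module.Projective (SmashProduct 𝕜 H A) (Π₀ k, DiagTensor 𝕜 A (X k)))

variable (H 𝒜 X δ) in
/-- The map `⨁ X k → ⨁ A ⊗ X k`. -/
def freeUnit : (Π₀ k, X k) →+ (freeModule H 𝒜 X δ).carrier :=
  DFinsupp.mapRange.addMonoidHom fun k => unitHom H 𝒜 (X k)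

theorem freeUnit_single (k : κ) (x : X k) :
    freeUnit H 𝒜 X δ (DFinsupp.single k x) = single H 𝒜 X δ k (unitHom H 𝒜 (X k) x) :=
  DFinsupp.mapRange_single (f := fun k => unitHom H 𝒜 (X k)) (hf := fun _ => map_zero _)

section Lift

variable {M : GradedModule H 𝒜} [Module 𝕜 M.carrier] [Module H M.carrier]
  [SmashTower 𝕜 H A M.carrier]

variable (δ) in
/-- The homomorphism `⨁ A ⊗ X k → M` that extends the maps `g k : X k → M`. -/
def freeLift (g : ∀ k, X k →ₗ[H] M.carrier) :
    (freeModule H 𝒜 X δ).carrier →ₗ[SmashProduct 𝕜 H A] M.carrier :=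
  -- `lsum` asks for auxiliary scalars commuting with the action; `A # H` need not be commutative,
  -- so `ℕ` is used.
  DFinsupp.lsum ℕ fun k => inducedLift (g k)

variable {g : ∀ k, X k →ₗ[H] M.carrier}

theorem freeLift_single (k : κ) (z : (inducedModule H 𝒜 (X k)).carrier) :
    freeLift δ g (single H 𝒜 X δ k z) = inducedLift (g k) z :=
  DFinsupp.lsum_single ℕ (fun k => inducedLift (g k)) k z

theorem freeLift_freeUnit (x : Π₀ k, X k) :
    freeLift δ g (freeUnit H 𝒜 X δ x) = DFinsupp.lsum ℕ g x := by
  induction x using DFinsupp.induction with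
  | h0 => simp only [map_zero]
  | ha k b f _ _ hf =>
    rw [map_add, map_add, map_add, hf, freeUnit_single, freeLift_single, inducedLift_unitHom,
      DFinsupp.lsum_single]

theorem isGradedHom_freeLift (hg : ∀ k x, g k x ∈ M.deg (δ k)) :
    IsGradedHom (freeLift δ g) := by
  intro d f hf
  have key : ∀ f : Π₀ k, (inducedModule H 𝒜 (X k)).carrier,
      (∀ k, f k ∈ (inducedModule H 𝒜 (X k)).deg (-δ k + d)) →
      DFinsupp.lsum ℕ (fun k => inducedLift (g k)) f ∈ M.deg d := by
    intro f
    induction f using DFinsupp.induction with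
    | h0 => intro _; rw [map_zero]; exact zero_mem _
    | ha k b f hk _ ih =>
      intro hf
      rw [map_add, DFinsupp.lsum_single]
      refine add_mem ?_ (ih fun l => ?_)
      · have h := hf k
        rw [DFinsupp.add_apply, DFinsupp.single_eq_same, hk, add_zero] at h
        have := inducedLift_mem_deg (hg k) h
        rwa [show -δ k + d + δ k = d by ring] at this
      · have h := hf l
        by_cases e : l = k
        · subst e
          rw [hk]
          exact zero_mem _
        · rwa [DFinsupp.add_apply, DFinsupp.single_eq_of_ne (by tauto), zero_add] at h
  exact key f hf

theorem range_freeLift_le {K : Submodule (SmashProduct 𝕜 H A) M.carrier}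
    (hg : ∀ k x, g k x ∈ K) : LinearMap.range (freeLift δ g) ≤ K := by
  rintro _ ⟨z, rfl⟩
  refine free_induction (C := fun z => freeLift δ g z ∈ K) ?_ (fun k z => ?_)
    (fun y z hy hz => ?_) z
  · rw [map_zero]
    exact zero_mem _
  · rw [freeLift_single]
    exact inducedLift_mem (hg k) z
  · rw [map_add]
    exact add_mem hy hz

theorem mem_range_freeLift (k : κ) (x : X k) : g k x ∈ LinearMap.range (freeLift δ g) :=
  ⟨single H 𝒜 X δ k (unitHom H 𝒜 (X k) x), by rw [freeLift_single, inducedLift_unitHom]⟩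

end Lift

variable [ConnectedGraded 𝒜]

variable (H 𝒜 X δ) in
/-- The map `⨁ A ⊗ X k → ⨁ X k`. -/
def freeCounit : (freeModule H 𝒜 X δ).carrier →+ (Π₀ k, X k) :=
  DFinsupp.mapRange.addMonoidHom fun k => counitHom H 𝒜 (X k)

theorem freeCounit_single (k : κ) (z : (inducedModule H 𝒜 (X k)).carrier) :
    freeCounit H 𝒜 X δ (single H 𝒜 X δ k z) = DFinsupp.single k (counitHom H 𝒜 (X k) z) :=
  DFinsupp.mapRange_single (f := fun k => counitHom H 𝒜 (X k)) (hf := fun _ => map_zero _)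

theorem map_positiveIdeal_smul_top {M N : GradedModule H 𝒜}
    (f : M.carrier →ₗ[SmashProduct 𝕜 H A] N.carrier) {z : M.carrier}
    (hz : z ∈ positiveIdeal H 𝒜 • (⊤ : Submodule (SmashProduct 𝕜 H A) M.carrier)) :
    f z ∈ positiveIdeal H 𝒜 • (⊤ : Submodule (SmashProduct 𝕜 H A) N.carrier) :=
  Submodule.smul_induction_on (p := fun z => f z ∈ positiveIdeal H 𝒜 •
    (⊤ : Submodule (SmashProduct 𝕜 H A) N.carrier)) hz
    (fun a ha y _ => by rw [map_smul]; exact Submodule.smul_mem_smul ha trivial)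
    fun x y hx hy => by rw [map_add]; exact add_mem hx hy

theorem sub_freeUnit_mem (z : (freeModule H 𝒜 X δ).carrier) :
    z - freeUnit H 𝒜 X δ (freeCounit H 𝒜 X δ z) ∈
      positiveIdeal H 𝒜 •
        (⊤ : Submodule (SmashProduct 𝕜 H A) (freeModule H 𝒜 X δ).carrier) := by
  refine free_induction (C := fun z => z - freeUnit H 𝒜 X δ (freeCounit H 𝒜 X δ z) ∈
    positiveIdeal H 𝒜 • (⊤ : Submodule (SmashProduct 𝕜 H A) (freeModule H 𝒜 X δ).carrier))
    ?_ (fun k z => ?_) (fun y z hy hz => ?_) z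
  · rw [map_zero, map_zero, sub_zero]
    exact zero_mem _
  · rw [freeCounit_single, freeUnit_single, ← map_sub]
    exact map_positiveIdeal_smul_top _ (sub_unitHom_mem z)
  · rw [map_add, map_add, add_sub_add_comm]
    exact add_mem hy hz

variable {M : GradedModule H 𝒜} [Module 𝕜 M.carrier] [Module H M.carrier]
  [SmashTower 𝕜 H A M.carrier] {g : ∀ k, X k →ₗ[H] M.carrier}

/-- The condition `hker` says that `⨁ X k` embeds into `K / J K`; the lower bound `c` on the degrees
of the generators makes Nakayama applicable to the source. -/
theorem isProjectiveCover_freeLift [IsSemisimpleRing H] {c : ℤ} (hδ : ∀ k, c ≤ δ k)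
    (hg : ∀ k x, g k x ∈ M.deg (δ k)) {K : Submodule (SmashProduct 𝕜 H A) M.carrier}
    (hK : LinearMap.range (freeLift δ g) = K)
    (hker : ∀ x, DFinsupp.lsum ℕ g x ∈ positiveIdeal H 𝒜 • K → x = 0) :
    IsProjectiveCover (freeLift δ g) K :=
  IsProjectiveCover.of_generators (P := freeModule H 𝒜 X δ) projective_free
    (boundedBelow_free hδ) (freeUnit H 𝒜 X δ) (freeCounit H 𝒜 X δ) sub_freeUnit_mem
    (isGradedHom_freeLift hg) hK fun x hx => hker x (by rwa [freeLift_freeUnit] at hx)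

end Free

/-! ### Existence of projective covers and minimal resolutions. -/

section Existence

variable [ConnectedGraded 𝒜] [IsSemisimpleRing H]

/-- In each degree, semisimplicity of `H` provides a complement of `J K` in `K`. These complements
generate `K` by Nakayama and embed into `K / J K`, so inducing them to `A # H` gives the cover. -/
theorem IsProjectiveCover.exists_of_boundedBelow {M : GradedModule H 𝒜} (hM : M.BoundedBelow)
    {K : Submodule (SmashProduct 𝕜 H A) M.carrier} (hK : M.IsGradedSubmodule K) :
    ∃ (P : GradedModule H 𝒜) (f : P.carrier →ₗ[SmashProduct 𝕜 H A] M.carrier),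
      P.BoundedBelow ∧ IsProjectiveCover f K := by
  have hM' := hM
  obtain ⟨c, hc⟩ := hM'
  let : Module 𝕜 M.carrier := scalarModule 𝕜 H A M.carrier
  let : Module H M.carrier := hopfModule 𝕜 H A M.carrier
  have : SmashTower 𝕜 H A M.carrier := smashTower_hopfModule M.carrier
  -- `D L d` is the degree `d` part of `L`; it is an `H`-submodule because each `1 # h` has degree
  -- `0`.
  let D : Submodule (SmashProduct 𝕜 H A) M.carrier → ℤ → Submodule H M.carrier := fun L d =>
    { carrier := {x | x ∈ L ∧ x ∈ M.deg d}
      zero_mem' := ⟨zero_mem _, zero_mem _⟩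
      add_mem' := fun hx hy => ⟨add_mem hx.1 hy.1, add_mem hx.2 hy.2⟩
      smul_mem' := fun h x hx => by
        rw [← SmashTower.mk_one_smul (𝕜 := 𝕜) (A := A)]
        refine ⟨L.smul_mem _ hx.1, ?_⟩
        have := M.smul_mem 0 d _ x
          (mk_mem_smashDegree (𝒜 := 𝒜) (n := 0) SetLike.GradedOne.one_mem h) hx.2
        rwa [Nat.cast_zero, zero_add] at this }
  let J := positiveIdeal H 𝒜 • K
  have hJK : J ≤ K := Submodule.smul_le_right
  have hJ : M.IsGradedSubmodule J := isGradedSubmodule_positiveIdeal_smul hK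
  choose C hC using fun k : ℕ => exists_isCompl (D J (c + k))
  -- `C k` is a complement in all of `M`; intersecting with the degree `c + k` part of `K`, which
  -- contains that of `J K`, gives a complement there by the modular law.
  let X : ℕ → Submodule H M.carrier := fun k => C k ⊓ D K (c + k)
  let g : ∀ k, X k →ₗ[H] M.carrier := fun k => (X k).subtype
  have hg : ∀ (k : ℕ) x, g k x ∈ M.deg (c + k) := fun k x => x.2.2.2
  have hgK : ∀ k x, g k x ∈ K := fun k x => x.2.2.1
  refine ⟨_, freeLift (κ := ℕ) (X := fun k : ℕ => X k) (fun k : ℕ => c + k) g,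
    boundedBelow_free (c := c) fun k => by omega,
    isProjectiveCover_freeLift (c := c) (fun k => by omega) hg ?_ fun x hx => ?_⟩
  · refine le_antisymm (range_freeLift_le hgK)
      (nakayama hM (isGradedSubmodule_range (isGradedHom_freeLift hg)) fun x hx => ?_)
    refine mem_of_proj_mem (K := (LinearMap.range
      (freeLift (X := fun k : ℕ => X k) (fun k : ℕ => c + k) g) ⊔ J).toAddSubgroup) fun d => ?_
    have hxd := isGradedSubmodule_iff.1 hK x hx d
    rcases lt_or_ge d c with hd | hd
    · have h0 := M.proj_mem d x
      rw [hc d hd, AddSubgroup.mem_bot] at h0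
      rw [h0]
      exact zero_mem _
    · obtain ⟨k, hk⟩ := Int.eq_ofNat_of_zero_le (sub_nonneg.2 hd)
      obtain rfl : d = c + k := by omega
      have ht : M.proj (c + k) x ∈ D J (c + k) ⊔ C k := by
        rw [(hC k).sup_eq_top]
        trivial
      obtain ⟨y, hy, z, hz, e⟩ := Submodule.mem_sup.1 ht
      rw [← e, add_comm]
      refine Submodule.add_mem_sup ?_ hy.1
      have hz' : z = M.proj (c + k) x - y := by rw [← e, add_sub_cancel_left]
      exact mem_range_freeLift (X := fun k : ℕ => X k) (g := g) k (⟨z, hz, by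
        rw [hz']
        exact ⟨sub_mem hxd (hJK hy.1), sub_mem (M.proj_mem _ _) hy.2⟩⟩ : X k)
  · have hp : ∀ (k : ℕ) (x : Π₀ k, X k), M.proj (c + k) (DFinsupp.lsum ℕ g x) = g k (x k) := by
      intro k x
      induction x using DFinsupp.induction with
      | h0 => simp
      | ha l b f _ _ hf =>
        rw [map_add, map_add, hf, DFinsupp.lsum_single, DFinsupp.add_apply, map_add]
        congr 1
        by_cases h : k = l
        · subst h
          rw [DFinsupp.single_eq_same, proj_of_mem (hg k b)]
        · rw [DFinsupp.single_eq_of_ne (by tauto), proj_of_mem_ne (hg l b) (by omega), map_zero]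
    refine DFinsupp.ext fun k => Subtype.ext ?_
    have h := isGradedSubmodule_iff.1 hJ _ hx (c + k)
    rw [hp] at h
    exact Submodule.disjoint_def.1 (hC k).disjoint _ ⟨h, hg k _⟩ (x k).2.1

/-- Bounded below graded modules have minimal projective resolutions. -/
theorem nonempty_minimalResolution {M : GradedModule H 𝒜} (hM : M.BoundedBelow) :
    Nonempty (MinimalResolution M) := by
  obtain ⟨P, f, hP, hf⟩ :=
    IsProjectiveCover.exists_of_boundedBelow hM (isGradedSubmodule_top (M := M))
  -- A state of the recursion is the current term of the resolution with the graded map out of it,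
  -- whose kernel is covered next.
  let T := Σ' (P Q : GradedModule H 𝒜) (f : P.carrier →ₗ[SmashProduct 𝕜 H A] Q.carrier),
    P.BoundedBelow ∧ IsGradedHom f
  have step : ∀ t : T, ∃ (R : GradedModule H 𝒜)
      (g : R.carrier →ₗ[SmashProduct 𝕜 H A] t.1.carrier),
      R.BoundedBelow ∧ IsProjectiveCover g (LinearMap.ker t.2.2.1) := fun t =>
    IsProjectiveCover.exists_of_boundedBelow t.2.2.2.1 (isGradedSubmodule_ker t.2.2.2.2)
  choose R g hR hg using step
  let s : ℕ → T := fun n =>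
    Nat.rec ⟨P, M, f, hP, hf.graded⟩ (fun _ t => ⟨R t, t.1, g t, hR t, (hg t).graded⟩) n
  exact ⟨{ Q := fun n => (s n).1
           π := f
           d := fun n => g (s n)
           cover_zero := hf
           cover_one := hg (s 0)
           cover_succ := fun n => hg (s (n + 1)) }⟩

end Existence

theorem boundedBelow_inflated [ConnectedGraded 𝒜] {X : Type u} [AddCommGroup X] [Module 𝕜 X] [Module H X]
    [IsScalarTower 𝕜 H X] : (inflatedModule H 𝒜 X).BoundedBelow :=
  ⟨0, fun d hd => if_neg (by omega)⟩

end GradedModule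

end FreeModules

/-- The augmentation ideal is generated by `W` as a left ideal. -/
theorem sub_augmentation_mem_span {𝕜 : Type u} [Field 𝕜] {A : Type u} [Ring A] [Algebra 𝕜 A]
    {𝒜 : ℕ → Submodule 𝕜 A} [GradedAlgebra 𝒜] [ConnectedGraded 𝒜] {W : Set A} (hW : ∀ w ∈ W, w ∈ 𝒜 1)
    (hgen : Algebra.adjoin 𝕜 W = ⊤) (a : A) :
    a - algebraMap 𝕜 A (augmentation 𝒜 a) ∈ Ideal.span W := by
  have ha : a ∈ Algebra.adjoin 𝕜 W := by rw [hgen]; trivial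
  induction ha using Algebra.adjoin_induction with
  | mem w hw =>
    rw [augmentation_of_mem one_ne_zero (hW w hw), map_zero, sub_zero]
    exact Ideal.subset_span hw
  | algebraMap c =>
    rw [augmentation_algebraMap, sub_self]
    exact zero_mem _
  | add x y _ _ hx hy =>
    rw [map_add, map_add, add_sub_add_comm]
    exact add_mem hx hy
  | mul x y _ _ hx hy =>
    -- The differences `y - ε(y)` and `x - ε(x)` stand on the right of their products, so a left
    -- ideal contains both terms.
    have e : x * y - algebraMap 𝕜 A (augmentation 𝒜 (x * y)) =
        x * (y - algebraMap 𝕜 A (augmentation 𝒜 y)) +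
          algebraMap 𝕜 A (augmentation 𝒜 y) * (x - algebraMap 𝕜 A (augmentation 𝒜 x)) := by
      rw [map_mul, map_mul, mul_sub, mul_sub, Algebra.commutes (augmentation 𝒜 y) x,
        Algebra.commutes (augmentation 𝒜 y) (algebraMap 𝕜 A (augmentation 𝒜 x))]
      abel
    rw [e]
    exact add_mem (Ideal.mul_mem_left _ _ hy) (Ideal.mul_mem_left _ _ hx)

/-! ### Homogeneous components, and the first term of the resolution. -/

section FirstTerm

variable {𝕜 : Type u} [Field 𝕜] {H : Type u} [Ring H] [HopfAlgebra 𝕜 H]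
  {A : Type u} [Ring A] [Algebra 𝕜 A] {𝒜 : ℕ → Submodule 𝕜 A}
  [Module H A] [HModuleAlgebra 𝕜 H A]

namespace GradedModule

section DegreeComponent

/-- `X` is the homogeneous component of degree `d` of `M`, as an `H`-module. -/
structure DegreeComponent (M : GradedModule H 𝒜) (d : ℤ) (X : Type u) [AddCommGroup X]
    [Module H X] where
  incl : X →+ M.carrier
  retr : M.carrier →+ X
  incl_mem : ∀ x, incl x ∈ M.deg d
  retr_incl : ∀ x, retr (incl x) = x
  incl_retr : ∀ z ∈ M.deg d, incl (retr z) = z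
  incl_smul : ∀ (h : H) x, incl (h • x) = (SmashProduct.mk 1 h : SmashProduct 𝕜 H A) • incl x

/-- Isomorphic graded modules have isomorphic homogeneous components. -/
theorem DegreeComponent.nonempty_equiv {M N : GradedModule H 𝒜} {d : ℤ} {X Y : Type u}
    [AddCommGroup X] [Module H X] [AddCommGroup Y] [Module H Y] (p : DegreeComponent M d X)
    (q : DegreeComponent N d Y) (h : M.Isomorphic N) : Nonempty (X ≃ₗ[H] Y) := by
  obtain ⟨e, he⟩ := h
  have h1 : ∀ x, q.incl (q.retr (e (p.incl x))) = e (p.incl x) := fun x =>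
    q.incl_retr _ ((he d _).2 (p.incl_mem x))
  have h2 : ∀ y, p.incl (p.retr (e.symm (q.incl y))) = e.symm (q.incl y) := fun y =>
    p.incl_retr _ ((he d _).1 (by rw [e.apply_symm_apply]; exact q.incl_mem y))
  exact ⟨{ toFun := fun x => q.retr (e (p.incl x))
           invFun := fun y => p.retr (e.symm (q.incl y))
           map_add' := fun x y => by simp only [map_add]
           map_smul' := fun h x => by
            rw [p.incl_smul, map_smul, ← h1, ← q.incl_smul, q.retr_incl, q.retr_incl]
            rfl
           left_inv := fun x => by
            change p.retr (e.symm (q.incl (q.retr (e (p.incl x))))) = x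
            rw [h1, e.symm_apply_apply, p.retr_incl]
           right_inv := fun y => by
            change q.retr (e (p.incl (p.retr (e.symm (q.incl y))))) = y
            rw [h2, e.apply_symm_apply, q.retr_incl] }⟩

variable [GradedAlgebra 𝒜] [GradedAction H 𝒜]

variable (H 𝒜) in
/-- The component of degree `0` of `A ⊗ X` is `X`. -/
def inducedComponent [ConnectedGraded 𝒜] (X : Type u) [AddCommGroup X] [Module 𝕜 X] [Module H X]
    [IsScalarTower 𝕜 H X] : DegreeComponent (inducedModule H 𝒜 X) 0 X where
  incl := unitHom H 𝒜 X
  retr := counitHom H 𝒜 X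
  incl_mem := unitHom_mem
  retr_incl := counitHom_unitHom
  incl_retr _ hz := unitHom_counitHom_of_mem hz
  incl_smul h x := ((unitMap 𝕜 H A X).map_smul h x).trans (SmashTower.mk_one_smul h _).symm

/-- The components of a shift. -/
def DegreeComponent.shift {M : GradedModule H 𝒜} {d : ℤ} {X : Type u} [AddCommGroup X]
    [Module H X] (p : DegreeComponent M d X) (c e : ℤ) (h : c + e = d) :
    DegreeComponent (M.shift c) e X where
  incl := p.incl
  retr := p.retr
  incl_mem x := by subst h; exact p.incl_mem x
  retr_incl := p.retr_incl
  incl_retr z hz := by subst h; exact p.incl_retr z hz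
  incl_smul := p.incl_smul

/-- The components of a direct sum. -/
def DegreeComponent.directSum {κ : Type} [Finite κ] {M : κ → GradedModule H 𝒜} {d : ℤ}
    {X : κ → Type u} [∀ k, AddCommGroup (X k)] [∀ k, Module H (X k)]
    (p : ∀ k, DegreeComponent (M k) d (X k)) :
    DegreeComponent (GradedModule.directSum M) d (∀ k, X k) where
  incl := AddMonoidHom.mk' (fun x k => (p k).incl (x k)) fun x y => by
    funext k
    exact map_add (p k).incl (x k) (y k)
  retr := AddMonoidHom.mk' (fun z k => (p k).retr (z k)) fun x y => by
    funext k
    exact map_add (p k).retr (x k) (y k)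
  incl_mem x k _ := (p k).incl_mem (x k)
  retr_incl x := funext fun k => (p k).retr_incl (x k)
  incl_retr z hz := funext fun k => (p k).incl_retr (z k) (hz k trivial)
  incl_smul h x := funext fun k => (p k).incl_smul h (x k)

end DegreeComponent

variable [GradedAlgebra 𝒜] [GradedAction H 𝒜]

/-- A finite direct sum of shifts of the modules `A ⊗ X k`. -/
theorem isomorphic_directSum {κ : Type} [DecidableEq κ] [Fintype κ] (X : κ → Type u)
    [∀ k, AddCommGroup (X k)] [∀ k, Module 𝕜 (X k)] [∀ k, Module H (X k)]
    [∀ k, IsScalarTower 𝕜 H (X k)] (c : ℤ) :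
    Isomorphic (freeModule H 𝒜 X fun _ => c)
      (directSum fun k => (inducedModule H 𝒜 (X k)).shift (-c)) :=
  ⟨DFinsupp.linearEquivFunOnFintype (M := fun k => (inducedModule H 𝒜 (X k)).carrier),
    fun _ _ => ⟨fun h k => h k trivial, fun h k _ => h k⟩⟩

section Inclusion

variable {V : Type u} [AddCommGroup V] [Module 𝕜 V] [Module H V] [IsScalarTower 𝕜 H V]

instance : Module 𝕜 (inducedModule H 𝒜 V).carrier := inferInstanceAs (Module 𝕜 (DiagTensor 𝕜 A V))

instance : Module H (inducedModule H 𝒜 V).carrier := inferInstanceAs (Module H (DiagTensor 𝕜 A V))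

instance : SmashTower 𝕜 H A (inducedModule H 𝒜 V).carrier :=
  inferInstanceAs (SmashTower 𝕜 H A (DiagTensor 𝕜 A V))

variable (W : Submodule H A)

theorem diagAction_rTensor (h : H) (z : W ⊗[𝕜] V) :
    (W.subtype.restrictScalars 𝕜).rTensor V (diagAction 𝕜 H W V h z) =
      diagAction 𝕜 H A V h ((W.subtype.restrictScalars 𝕜).rTensor V z) := by
  induction z using TensorProduct.induction_on with
  | zero => simp only [map_zero]
  | add x y hx hy => simp only [map_add, hx, hy]
  | tmul w v =>
    rw [LinearMap.rTensor_tmul, diagAction_apply_tmul, diagAction_apply_tmul]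
    induction (Coalgebra.comul (R := 𝕜) h) using TensorProduct.induction_on with
    | zero => simp only [map_zero]
    | add x y hx hy => simp only [map_add, hx, hy]
    | tmul x y => simp

variable (𝒜 V) in
/-- The inclusion `W ⊗ V → A ⊗ V`. -/
def tensorInclusion : DiagTensor 𝕜 W V →ₗ[H] (inducedModule H 𝒜 V).carrier where
  toFun := (W.subtype.restrictScalars 𝕜).rTensor V
  map_add' := map_add ((W.subtype.restrictScalars 𝕜).rTensor V)
  map_smul' h z := diagAction_rTensor W h z

variable {W}

theorem tensorInclusion_mk (w : W) (v : V) :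
    tensorInclusion 𝒜 V W (DiagTensor.mk 𝕜 w v) = tmul H 𝒜 (w : A) v := rfl

/-- Over a field `V` is flat. -/
theorem tensorInclusion_injective : Function.Injective (tensorInclusion 𝒜 V W) :=
  Module.Flat.rTensor_preserves_injective_linearMap (W.subtype.restrictScalars 𝕜)
    W.injective_subtype

theorem tensorInclusion_mem (hW : ∀ w ∈ W, w ∈ 𝒜 1) (z : DiagTensor 𝕜 W V) :
    tensorInclusion 𝒜 V W z ∈ (inducedModule H 𝒜 V).deg 1 := by
  induction z using DiagTensor.induction with
  | zero => rw [map_zero]; exact zero_mem _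
  | add x y hx hy => rw [map_add]; exact add_mem hx hy
  | mk w v => exact tmul_mem_deg (n := 1) (hW w w.2) v

variable [ConnectedGraded 𝒜]

theorem counitMap_tensorInclusion (hW : ∀ w ∈ W, w ∈ 𝒜 1) (z : DiagTensor 𝕜 W V) :
    counitMap H 𝒜 V (tensorInclusion 𝒜 V W z) = 0 := by
  induction z using DiagTensor.induction with
  | zero => rw [map_zero, map_zero]
  | add x y hx hy => rw [map_add, map_add, hx, hy, add_zero]
  | mk w v =>
    rw [tensorInclusion_mk, counitMap_tmul, augmentation_of_mem one_ne_zero (hW w w.2), zero_smul,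
      map_zero]

/-- The kernel of `A ⊗ V → V` starts in degree `1` and `J` raises degrees, so the product starts in
degree `2`. This is what makes the cover generated by `W ⊗ V` minimal. -/
theorem proj_one_eq_zero {z : (inducedModule H 𝒜 V).carrier}
    (hz : z ∈ positiveIdeal H 𝒜 • LinearMap.ker (counitMap H 𝒜 V)) :
    (inducedModule H 𝒜 V).proj 1 z = 0 := by
  refine Submodule.smul_induction_on (p := fun z => (inducedModule H 𝒜 V).proj 1 z = 0) hz
    (fun a ha y hy => ?_) fun x y hx hy => by rw [map_add, hx, hy, add_zero]
  refine positiveIdeal_induction (C := fun a => (inducedModule H 𝒜 V).proj 1 (a • y) = 0)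
    ?_ (fun n hn a ha h => ?_) (fun p q hp hq => ?_) ha
  · rw [zero_smul, map_zero]
  · have e := proj_smul (M := inducedModule H 𝒜 V) (mk_mem_smashDegree ha h) (1 - n) y
    rw [show (n : ℤ) + (1 - n) = 1 by ring] at e
    have hp := (inducedModule H 𝒜 V).proj_mem (1 - n) y
    have : (inducedModule H 𝒜 V).proj (1 - n) y = 0 := by
      -- For `n ≥ 2` the degree `1 - n` is negative. For `n = 1` the degree zero part of `y` is `1 ⊗
      -- v`, with `v` its image under the counit map, which is zero.
      rcases lt_or_ge (1 - (n : ℤ)) 0 with h0 | h0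
      · rwa [deg_neg h0, AddSubgroup.mem_bot] at hp
      · obtain rfl : n = 1 := by omega
        rw [Nat.cast_one, sub_self] at hp ⊢
        have h1 : counitMap H 𝒜 V ((inducedModule H 𝒜 V).proj 0 y) = 0 := by
          rw [← proj_comm isGradedHom_counitMap, LinearMap.mem_ker.1 hy, map_zero]
        rw [← unitHom_counitHom_of_mem hp, counitHom_apply, h1, map_zero, map_zero]
    rw [e, this, smul_zero]
  · rw [add_smul, map_add, hp, hq, add_zero]

variable {κ : Type} [DecidableEq κ] [Fintype κ] {X : κ → Type u}
  [∀ k, AddCommGroup (X k)] [∀ k, Module 𝕜 (X k)] [∀ k, Module H (X k)]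
  [∀ k, IsScalarTower 𝕜 H (X k)]

/-- If `W ⊗ V` is the direct sum of the modules `X k`, then the direct sum of the modules
`(A ⊗ X k)[-1]` is a projective cover of the kernel of `A ⊗ V → V`. -/
theorem exists_cover_ker_counitMap [IsSemisimpleRing H] (hW : ∀ w ∈ W, w ∈ 𝒜 1)
    (hgen : Algebra.adjoin 𝕜 (W : Set A) = ⊤) (e : DiagTensor 𝕜 W V ≃ₗ[H] (∀ k, X k)) :
    ∃ f : (freeModule H 𝒜 X fun _ => 1).carrier →ₗ[SmashProduct 𝕜 H A]
        (inducedModule H 𝒜 V).carrier,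
      IsProjectiveCover f (LinearMap.ker (counitMap H 𝒜 V)) := by
  let g : ∀ k, X k →ₗ[H] (inducedModule H 𝒜 V).carrier := fun k =>
    tensorInclusion 𝒜 V W ∘ₗ e.symm.toLinearMap ∘ₗ LinearMap.single H X k
  have hg : ∀ x : Π₀ k, X k, DFinsupp.lsum ℕ g x = tensorInclusion 𝒜 V W (e.symm x) := by
    intro x
    induction x using DFinsupp.induction with
    | h0 => rw [map_zero, DFinsupp.coe_zero, map_zero, map_zero]
    | ha k b f _ _ hf =>
      rw [map_add, hf, DFinsupp.lsum_single, DFinsupp.coe_add, map_add, map_add,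
        DFinsupp.single_eq_pi_single]
      rfl
  have hg_apply : ∀ k x, g k x = tensorInclusion 𝒜 V W (e.symm (LinearMap.single H X k x)) :=
    fun _ _ => rfl
  have hdeg : ∀ k x, g k x ∈ (inducedModule H 𝒜 V).deg 1 := fun k x => by
    rw [hg_apply]
    exact tensorInclusion_mem hW _
  have hker : ∀ k x, g k x ∈ LinearMap.ker (counitMap H 𝒜 V) := fun k x => by
    rw [hg_apply, LinearMap.mem_ker, counitMap_tensorInclusion hW]
  refine ⟨freeLift (fun _ => 1) g, isProjectiveCover_freeLift (c := 1) (fun _ => le_rfl)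
    hdeg (le_antisymm ?_ fun z hz => ?_) fun x hx => ?_⟩
  · exact range_freeLift_le hker
  -- Surjectivity onto the kernel is proved as a statement about all `z`, so that it can be checked
  -- on pure tensors: there the difference is `(a - ε(a)) ⊗ v`, and `a - ε(a)` lies in the left
  -- ideal generated by `W`.
  · have key : ∀ z, z - unitHom H 𝒜 V (counitHom H 𝒜 V z) ∈
        LinearMap.range (freeLift (fun _ => 1) g) := by
      intro z
      induction z using induced_induction with
      | zero => rw [map_zero, map_zero, sub_zero]; exact zero_mem _
      | add x y hx hy => rw [map_add, map_add, add_sub_add_comm]; exact add_mem hx hy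
      | mk a v =>
        rw [tmul_sub_unitHom]
        refine Submodule.span_induction (p := fun b _ => tmul H 𝒜 b v ∈
          LinearMap.range (freeLift (fun _ => 1) g)) (fun w hw => ?_) ?_ (fun x y _ _ hx hy => ?_)
          (fun b x _ hx => ?_) (sub_augmentation_mem_span hW hgen a)
        · refine ⟨freeUnit H 𝒜 X (fun _ => 1)
            (DFinsupp.equivFunOnFintype.symm (e (DiagTensor.mk 𝕜 ⟨w, hw⟩ v))), ?_⟩
          rw [freeLift_freeUnit, hg]
          refine (congrArg (fun y => tensorInclusion 𝒜 V W (e.symm y))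
            (DFinsupp.equivFunOnFintype.apply_symm_apply (e (DiagTensor.mk 𝕜 ⟨w, hw⟩ v)))).trans ?_
          rw [e.symm_apply_apply, tensorInclusion_mk]
        · rw [tmul_zero_left]
          exact zero_mem _
        · rw [tmul_add_left]
          exact add_mem hx hy
        · rw [smul_eq_mul, ← mk_smul_tmul]
          exact Submodule.smul_mem _ _ hx
    have := key z
    rwa [counitHom_apply, LinearMap.mem_ker.1 hz, map_zero, map_zero, sub_zero] at this
  -- The image of `x` is concentrated in degree `1`, where `J` times the kernel vanishes;
  -- injectivity of `W ⊗ V → A ⊗ V` then gives `x = 0`.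
  · have h := proj_one_eq_zero hx
    rw [hg, proj_of_mem (tensorInclusion_mem hW _)] at h
    have h := e.symm.map_eq_zero_iff.1 (tensorInclusion_injective (h.trans (map_zero _).symm))
    exact DFinsupp.ext fun k => congrFun h k

/-- The first term of a minimal projective resolution of `V`. -/
theorem MinimalResolution.isomorphic_directSum [IsSemisimpleRing H] (hW : ∀ w ∈ W, w ∈ 𝒜 1)
    (hgen : Algebra.adjoin 𝕜 (W : Set A) = ⊤) (e : DiagTensor 𝕜 W V ≃ₗ[H] (∀ k, X k))
    (R : MinimalResolution (inflatedModule H 𝒜 V)) :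
    Isomorphic (R.Q 1) (directSum fun k => (inducedModule H 𝒜 (X k)).shift (-1)) := by
  obtain ⟨f, hf⟩ := exists_cover_ker_counitMap hW hgen e
  obtain ⟨e₀, he₀, h⟩ := R.cover_zero.exists_equiv (isProjectiveCover_counitMap (X := V))
  have hker : (LinearMap.ker R.π).map e₀.toLinearMap = LinearMap.ker (counitMap H 𝒜 V) := by
    ext z
    rw [Submodule.mem_map_equiv, LinearMap.mem_ker, LinearMap.mem_ker, ← h,
      LinearEquiv.apply_symm_apply]
  have hR := R.cover_one.comp_equiv e₀ he₀
  rw [hker] at hR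
  obtain ⟨e₁, he₁, -⟩ := hR.exists_equiv hf
  exact Isomorphic.trans ⟨e₁, he₁⟩ (GradedModule.isomorphic_directSum X 1)

end Inclusion

end GradedModule

end FirstTerm

/-! ### Existence, uniqueness and comparison of the two matrices. -/

section Quivers

variable {𝕜 : Type u} [Field 𝕜] {H : Type u} [Ring H] [HopfAlgebra 𝕜 H]
  {A : Type u} [Ring A] [Algebra 𝕜 A] [Module H A] [HModuleAlgebra 𝕜 H A]
  {ι : Type} {V : ι → Type u} [∀ i, AddCommGroup (V i)] [∀ i, Module 𝕜 (V i)]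
  [∀ i, Module H (V i)] [∀ i, IsScalarTower 𝕜 H (V i)]

/-- The module `V i` is recovered from `A ⊗ V i` as its degree zero component. -/
theorem eq_of_isomorphic_induced (𝒜 : ℕ → Submodule 𝕜 A) [GradedAlgebra 𝒜] [ConnectedGraded 𝒜]
    [GradedAction H 𝒜] (hdistinct : ∀ i j, Nonempty (V i ≃ₗ[H] V j) → i = j) {i j : ι}
    (h : GradedModule.Isomorphic (inducedModule H 𝒜 (V i)) (inducedModule H 𝒜 (V j))) : i = j :=
  hdistinct i j <| (GradedModule.inducedComponent H 𝒜 (V i)).nonempty_equiv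
    (GradedModule.inducedComponent H 𝒜 (V j)) h

theorem exists_isMcKayMatrix [IsSemisimpleRing H] [∀ i, Module.Finite 𝕜 (V i)]
    (hcomplete : ∀ (S : Type u) [AddCommGroup S] [Module H S],
      IsSimpleModule H S → ∃ i, Nonempty (S ≃ₗ[H] V i))
    (W : Type u) [AddCommGroup W] [Module 𝕜 W] [Module H W] [IsScalarTower 𝕜 H W]
    [Module.Finite 𝕜 W] : ∃ n, IsMcKayMatrix 𝕜 H V W n := by
  have fin : ∀ j, Module.Finite H (DiagTensor 𝕜 W (V j)) := fun j => by
    have : Module.Finite 𝕜 (DiagTensor 𝕜 W (V j)) :=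
      inferInstanceAs (Module.Finite 𝕜 (W ⊗[𝕜] V j))
    exact Module.Finite.of_restrictScalars_finite 𝕜 H _
  choose n hn using fun j => exists_multiplicity hcomplete (DiagTensor 𝕜 W (V j))
  -- The choice was made for each column `j`, hence the transposition.
  exact ⟨fun i j => n j i, hn⟩

variable [Fintype ι]

theorem IsMcKayMatrix.unique [∀ i, Module.Finite 𝕜 (V i)]
    (hsimple : ∀ i, IsSimpleModule H (V i))
    (hdistinct : ∀ i j, Nonempty (V i ≃ₗ[H] V j) → i = j)
    {W : Type u} [AddCommGroup W] [Module 𝕜 W] [Module H W] [IsScalarTower 𝕜 H W]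
    {m n : ι → ι → ℕ} (hm : IsMcKayMatrix 𝕜 H V W m) (hn : IsMcKayMatrix 𝕜 H V W n) : m = n := by
  funext i j
  obtain ⟨e⟩ := hm j
  obtain ⟨f⟩ := hn j
  exact congrFun (multiplicity_unique (𝕜 := 𝕜) (m := fun i => m i j) (n := fun i => n i j)
    hsimple hdistinct (e.symm.trans f)) i

/-- Two decompositions of the first term have isomorphic degree `1` components. These are sums of
the `V i` with the same multiplicities, so uniqueness over `H` applies. -/
theorem IsGabrielMatrix.unique [∀ i, Module.Finite 𝕜 (V i)] {𝒜 : ℕ → Submodule 𝕜 A}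
    [GradedAlgebra 𝒜] [ConnectedGraded 𝒜] [GradedAction H 𝒜]
    (hsimple : ∀ i, IsSimpleModule H (V i))
    (hdistinct : ∀ i j, Nonempty (V i ≃ₗ[H] V j) → i = j)
    {R : ∀ j, GradedModule.MinimalResolution (inflatedModule H 𝒜 (V j))}
    {m n : ι → ι → ℕ} (hm : IsGabrielMatrix V 𝒜 R m) (hn : IsGabrielMatrix V 𝒜 R n) : m = n := by
  funext i j
  let p : ∀ k : ι → ι → ℕ, GradedModule.DegreeComponent (GradedModule.directSum
      fun x : Σ i, Fin (k i j) => (inducedModule H 𝒜 (V x.1)).shift (-1)) 1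
      (∀ x : Σ i, Fin (k i j), V x.1) := fun k =>
    GradedModule.DegreeComponent.directSum fun x =>
      (GradedModule.inducedComponent H 𝒜 (V x.1)).shift (-1) 1 (by norm_num)
  obtain ⟨e⟩ := (p m).nonempty_equiv (p n) ((hm j).symm.trans (hn j))
  exact congrFun (multiplicity_unique (𝕜 := 𝕜) (m := fun i => m i j) (n := fun i => n i j)
    hsimple hdistinct e) i

/-- The heart of the comparison: a decomposition of `W ⊗ V j` over `H` induces, summand by summand,
one of the first term over `A # H`. -/
theorem IsMcKayMatrix.isGabrielMatrix [DecidableEq ι] [IsSemisimpleRing H]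
    {𝒜 : ℕ → Submodule 𝕜 A} [GradedAlgebra 𝒜] [ConnectedGraded 𝒜] [GradedAction H 𝒜]
    {W : Submodule H A} (hW : ∀ w ∈ W, w ∈ 𝒜 1) (hgen : Algebra.adjoin 𝕜 (W : Set A) = ⊤)
    {n : ι → ι → ℕ} (hn : IsMcKayMatrix 𝕜 H V W n)
    (R : ∀ j, GradedModule.MinimalResolution (inflatedModule H 𝒜 (V j))) :
    IsGabrielMatrix V 𝒜 R n := fun j =>
  (R j).isomorphic_directSum hW hgen (hn j).some

end Quivers

end HopfMcKay

end

/-! ### The main theorem. -/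

theorem theorem2p10 {𝕜 : Type u} [Field 𝕜] [IsAlgClosed 𝕜] [CharZero 𝕜]
    {H : Type u} [Ring H] [HopfAlgebra 𝕜 H] [IsSemisimpleRing H]
    {A : Type u} [Ring A] [Algebra 𝕜 A] [Module H A] [HopfMcKay.HModuleAlgebra 𝕜 H A]
    (𝒜 : ℕ → Submodule 𝕜 A) [GradedAlgebra 𝒜] [HopfMcKay.ConnectedGraded 𝒜]
    [HopfMcKay.GradedAction H 𝒜]
    (W : Submodule H A) [FiniteDimensional 𝕜 W] (hW : ∀ w ∈ W, w ∈ 𝒜 1)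
    (hgen : Algebra.adjoin 𝕜 (W : Set A) = ⊤)
    {s : ℕ} (V : Fin (s + 1) → Type u) [∀ i, AddCommGroup (V i)] [∀ i, Module 𝕜 (V i)]
    [∀ i, Module H (V i)] [∀ i, IsScalarTower 𝕜 H (V i)]
    (hsimple : ∀ i, IsSimpleModule H (V i))
    (hdistinct : ∀ i j, Nonempty (V i ≃ₗ[H] V j) → i = j)
    (hcomplete : ∀ (S : Type u) [AddCommGroup S] [Module H S],
      IsSimpleModule H S → ∃ i, Nonempty (S ≃ₗ[H] V i)) :
    -- the vertices `P⁽ⁱ⁾` of the Gabriel quiver are pairwise distinct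
    (∀ i j, HopfMcKay.GradedModule.Isomorphic
      (HopfMcKay.inducedModule H 𝒜 (V i)) (HopfMcKay.inducedModule H 𝒜 (V j)) → i = j) ∧
    -- minimal projective resolutions exist
    (∀ j, Nonempty
      (HopfMcKay.GradedModule.MinimalResolution (HopfMcKay.inflatedModule H 𝒜 (V j)))) ∧
    -- the multiplicities that define the two quivers exist and are unique
    (∀ R : ∀ j, HopfMcKay.GradedModule.MinimalResolution (HopfMcKay.inflatedModule H 𝒜 (V j)),
      ∃! m, HopfMcKay.IsGabrielMatrix V 𝒜 R m) ∧
    (∃! n, HopfMcKay.IsMcKayMatrix 𝕜 H V W n) ∧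
    -- the two quivers are isomorphic, through the vertex map `P⁽ⁱ⁾ ↦ V⁽ⁱ⁾`
    ∀ (R : ∀ j, HopfMcKay.GradedModule.MinimalResolution (HopfMcKay.inflatedModule H 𝒜 (V j)))
      (m n : Fin (s + 1) → Fin (s + 1) → ℕ),
      HopfMcKay.IsGabrielMatrix V 𝒜 R m → HopfMcKay.IsMcKayMatrix 𝕜 H V W n →
        ∃ e : CategoryTheory.Quiv.of (HopfMcKay.MultQuiver m) ≅
            CategoryTheory.Quiv.of (HopfMcKay.MultQuiver n),
          ∀ i, e.hom.obj ⟨i⟩ = ⟨i⟩ := by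
  have fin : ∀ i, Module.Finite 𝕜 (V i) := fun i =>
    have := hsimple i
    HopfMcKay.finite_of_isSimpleModule 𝕜 H (V i)
  obtain ⟨n₀, hn₀⟩ := HopfMcKay.exists_isMcKayMatrix (𝕜 := 𝕜) hcomplete W
  refine ⟨fun i j h => HopfMcKay.eq_of_isomorphic_induced 𝒜 hdistinct h,
    fun j => HopfMcKay.GradedModule.nonempty_minimalResolution
      HopfMcKay.GradedModule.boundedBelow_inflated,
    fun R => ⟨n₀, hn₀.isGabrielMatrix hW hgen R, fun m hm =>
      hm.unique hsimple hdistinct (hn₀.isGabrielMatrix hW hgen R)⟩,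
    ⟨n₀, hn₀, fun n hn => hn.unique hsimple hdistinct hn₀⟩, fun R m n hm hn => ?_⟩
  -- By uniqueness `m = n`, so both quivers are the same and the identity serves.
  obtain rfl := hm.unique hsimple hdistinct (hn.isGabrielMatrix hW hgen R)
  exact ⟨CategoryTheory.Iso.refl _, fun _ => rfl⟩
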